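/- Let $p,m\ge 1$, $n=p+m$, and let $\Lambda=\mathrm{diag}(\lambda_1,\dots,\lambda_n)$ with $\lambda_k:[0,1]\to\mathbb R$ Lipschitz continuous and $$\lambda_1(x)\le\dots\le\lambda_p(x)<0<\lambda_{p+1}(x)\le\dots\le\lambda_{p+m}(x),\qquad x\in[0,1].$$ Let $Q\in\mathbb R^{p\times m}$. Write $y=(y_+,y_-)\in\mathbb R^p\times\mathbb R^m$, $\Lambda_+=\mathrm{diag}(\lambda_1,\dots,\lambda_p)$, $\Lambda_-=\mathrm{diag}(\lambda_{p+1},\dots,\lambda_n)$, and consider the system $$\partial_t y(t,x)=\Lambda(x)\,\partial_x y(t,x),\qquad y_+(t,0)=Q\,y_-(t,0),\quad y_-(t,1)=u(t),\quad y(0,x)=y^0(x),\qquad t>0,\ x\in(0,1).\tag{S}$$ *Solutions.* For $y^0\in L^2(0,1)^n$ and $u\in L^2(0,+\infty)^m$, a (weak) solution of (S) is a function $y\in C^0([0,+\infty);L^2(0,1)^n)$ such that for every $T>0$ $$\int_0^1 y(T,x)\cdot\varphi(T,x)\,dx-\int_0^1 y^0(x)\cdot\varphi(0,x)\,dx=\int_0^T\!\!\int_0^1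 y\cdot\big(\partial_t\varphi-\Lambda\,\partial_x\varphi-(\partial_x\Lambda)\varphi\big)\,dx\,dt+\int_0^T u(t)\cdot\Lambda_-(1)\varphi_-(t,1)\,dt$$ for every $\varphi\in C^1([0,T]\times[0,1])^n$ with $\varphi_+(\cdot,1)=0$ and $\varphi_-(\cdot,0)=R^*\varphi_+(\cdot,0)$, where $R=-\Lambda_+(0)\,Q\,\Lambda_-(0)^{-1}$. The system is *exactly controllable in time $T$* if for all $y^0,y^1\in L^2(0,1)^n$ there is $u\in L^2(0,+\infty)^m$ such that the corresponding solution satisfies $y(T)=y^1$. *Times.* For $k\in\{1,\dots,n\}$, $T_k(\Lambda)$ is the time that the characteristic $\chi'(s)=-\lambda_k(\chi(s))$ needs to cross $[0,1]$, from $\chi(0)=0$ to $\chi(T_k(\Lambda))=1$ if $k\le p$, and from $\chi(0)=1$ to $\chi(T_k(\Lambda))=0$ if $k>p$ (equivalently, $T_k(\Lambda)=\int_0^1|\lambda_k(x)|^{-1}dx$). *Indices.* A matrix $Q^0\in\mathbb R^{p\times m}$ is in canonical form if there are distinct column indices $c_1,\dots,c_p\in\{1,\dots,m\}$ such that, for every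 $i$: $q^0_{i,c_i}\ne0$; $q^0_{i,j}=0$ for all $j>c_i$ with $j\notin\{c_{i+1},\dots,c_p\}$; and $q^0_{i,j}=0$ for all $j<c_i$. Such indices are unique. If $\operatorname{rank}Q=p$, there is exactly one matrix $Q^0$ in canonical form such that $Q^0=QL$ for some lower triangular $L\in\mathbb R^{m\times m}$ with only ones on its diagonal; $c_1(Q),\dots,c_p(Q)$ denote the indices $c_1,\dots,c_p$ of this $Q^0$. **Theorem.** For every $T>0$, the system (S) is exactly controllable in time $T$ if, and only if, $\operatorname{rank}Q=p$ and $$T\ \ge\ \max_{i\in\{1,\dots,p\}}\big(T_{p+1}(\Lambda),\ T_i(\Lambda)+T_{p+c_i(Q)}(\Lambda)\big).$$ -/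

import Mathlib

open MeasureTheory Set

namespace HyperbolicControl

noncomputable section

/-- `χ` is a characteristic, `χ' = -lam (χ)`, that runs inside `[0,1]` from `χ 0 = a` to
`χ s = b`. -/
def IsCharacteristic (lam : ℝ → ℝ) (a b s : ℝ) (χ : ℝ → ℝ) : Prop :=
  χ 0 = a ∧ χ s = b ∧
    ∀ r ∈ Icc (0 : ℝ) s, χ r ∈ Icc (0 : ℝ) 1 ∧
      HasDerivWithinAt χ (-lam (χ r)) (Icc 0 s) r

/-- The time at which the characteristic of speed `-lam` started at `a` at time `0` reaches `b`.
For a speed without zero on `[0,1]` and `{a, b} = {0, 1}` (in the right order) the set below has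
exactly one element. -/
def exitTime (lam : ℝ → ℝ) (a b : ℝ) : ℝ :=
  sInf {s | 0 ≤ s ∧ ∃ χ : ℝ → ℝ, IsCharacteristic lam a b s χ}

/-- A component of negative speed has exactly one exit time. -/
theorem exitTimes_neg {lam : ℝ → ℝ} (hc : ContinuousOn lam (Icc 0 1))
    (hneg : ∀ x ∈ Icc (0 : ℝ) 1, lam x < 0) :
    {s | 0 ≤ s ∧ ∃ χ : ℝ → ℝ, IsCharacteristic lam 0 1 s χ} = {∫ x in (0 : ℝ)..1, -(lam x)⁻¹} := by
  let g : ℝ → ℝ := fun x => -(lam (projIcc 0 1 zero_le_one x))⁻¹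
  have hproj : ∀ x ∈ Icc (0 : ℝ) 1, (projIcc (0 : ℝ) 1 zero_le_one x : ℝ) = x := fun x hx => by
    rw [projIcc_of_mem _ hx]
  have hgc : Continuous g := by
    have h1 : Continuous fun x : ℝ => lam (projIcc 0 1 zero_le_one x) :=
      hc.comp_continuous (continuous_subtype_val.comp continuous_projIcc)
        fun x => (projIcc (0 : ℝ) 1 zero_le_one x).2
    exact (h1.inv₀ fun x => (hneg _ (projIcc (0 : ℝ) 1 zero_le_one x).2).ne).neg
  have hgpos : ∀ x, 0 < g x := fun x => by
    have := inv_lt_zero.2 (hneg _ (projIcc (0 : ℝ) 1 zero_le_one x).2)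
    simp only [g]; linarith
  have hgeq : ∀ x ∈ Icc (0 : ℝ) 1, g x = -(lam x)⁻¹ := fun x hx => by simp only [g, hproj x hx]
  let φ : ℝ → ℝ := fun x => ∫ ξ in (0 : ℝ)..x, g ξ
  have hφ : ∀ x, HasDerivAt φ (g x) x := fun x => hgc.integral_hasStrictDerivAt 0 x |>.hasDerivAt
  have hφ0 : φ 0 = 0 := intervalIntegral.integral_same
  have hφ1 : φ 1 = ∫ x in (0 : ℝ)..1, -(lam x)⁻¹ :=
    intervalIntegral.integral_congr fun x hx => hgeq x (by rwa [uIcc_of_le zero_le_one] at hx)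
  have hmono : StrictMono φ := strictMono_of_deriv_pos fun x => by rw [(hφ x).deriv]; exact hgpos x
  have hcont : Continuous φ := continuous_iff_continuousAt.2 fun x => (hφ x).continuousAt
  rw [← hφ1]
  ext s
  simp only [mem_ofPred_eq, mem_singleton_iff]
  constructor
  · rintro ⟨hs, χ, h0, h1, hχ⟩
    have hd : ∀ r ∈ Icc (0 : ℝ) s, HasDerivWithinAt (fun r => φ (χ r) - r) 0 (Icc 0 s) r := by
      intro r hr
      have h2 := ((hφ (χ r)).comp_hasDerivWithinAt r (hχ r hr).2).sub (hasDerivWithinAt_id r _)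
      have h3 : g (χ r) * -lam (χ r) - 1 = 0 := by
        rw [hgeq _ (hχ r hr).1]
        have := (hneg _ (hχ r hr).1).ne
        field_simp
        ring
      rw [h3] at h2
      exact h2
    have hcst := constant_of_has_deriv_right_zero (f := fun r => φ (χ r) - r)
      (fun r hr => (hd r hr).continuousWithinAt)
      (fun r hr => ((hd r ⟨hr.1, hr.2.le⟩).mono_of_mem_nhdsWithin
        (Icc_mem_nhdsGE_of_mem ⟨hr.1, hr.2⟩))) s ⟨hs, le_rfl⟩
    simp only [h0, h1, hφ0] at hcst
    linarith
  · rintro rfl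
    have h01 : φ 0 < φ 1 := hmono zero_lt_one
    rw [hφ0] at h01
    have hsurj : Function.Surjective φ := by
      obtain ⟨x0, -, hx0⟩ := isCompact_Icc.exists_isMinOn (nonempty_Icc.2 zero_le_one)
        (hgc.continuousOn (s := Icc (0 : ℝ) 1))
      have hmin : ∀ x, g x0 ≤ deriv φ x := fun x => by
        rw [(hφ x).deriv]
        have h2 : g (projIcc 0 1 zero_le_one x) = g x := by simp only [g, projIcc_val]
        rw [← h2]
        exact hx0 (projIcc (0 : ℝ) 1 zero_le_one x).2
      have hgrow := mul_sub_le_image_sub_of_le_deriv (fun x => (hφ x).differentiableAt) hmin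
      refine hcont.surjective ?_ ?_
      · refine Filter.tendsto_atTop_mono' _ ?_ (Filter.tendsto_id.const_mul_atTop (hgpos x0))
        filter_upwards [Filter.eventually_ge_atTop 0] with x hx
        have := hgrow hx
        simp only [id]
        linarith
      · refine Filter.tendsto_atBot_mono' _ ?_ (Filter.tendsto_id.const_mul_atBot (hgpos x0))
        filter_upwards [Filter.eventually_le_atBot 0] with x hx
        have := hgrow hx
        simp only [id]
        linarith
    let e := hmono.orderIsoOfSurjective φ hsurj
    have he : ∀ r, φ (e.symm r) = r := fun r => e.apply_symm_apply r
    have he' : ∀ x, e.symm (φ x) = x := fun x => e.symm_apply_apply x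
    refine ⟨h01.le, e.symm, ?_, he' 1, fun r hr => ?_⟩
    · have := he' 0
      rwa [hφ0] at this
    · have hmem : e.symm r ∈ Icc (0 : ℝ) 1 := by
        constructor
        · rw [← hmono.le_iff_le, he, hφ0]; exact hr.1
        · rw [← hmono.le_iff_le, he]; exact hr.2
      refine ⟨hmem, HasDerivAt.hasDerivWithinAt ?_⟩
      have := (hφ (e.symm r)).of_local_left_inverse e.symm.continuous.continuousAt
        (hgpos _).ne' (Filter.Eventually.of_forall he)
      rwa [hgeq _ hmem, inv_neg, inv_inv] at this

/-- A component of positive speed has exactly one exit time. -/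
theorem exitTimes_pos {lam : ℝ → ℝ} (hc : ContinuousOn lam (Icc 0 1))
    (hpos : ∀ x ∈ Icc (0 : ℝ) 1, 0 < lam x) :
    {s | 0 ≤ s ∧ ∃ χ : ℝ → ℝ, IsCharacteristic lam 1 0 s χ} = {∫ x in (0 : ℝ)..1, (lam x)⁻¹} := by
  have hrefl : ∀ x ∈ Icc (0 : ℝ) 1, 1 - x ∈ Icc (0 : ℝ) 1 := fun x hx =>
    ⟨by linarith [hx.2], by linarith [hx.1]⟩
  have h := exitTimes_neg (lam := fun x => -lam (1 - x))
    ((hc.comp (by fun_prop) hrefl).neg) (fun x hx => neg_lt_zero.2 (hpos _ (hrefl x hx)))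
  have hint : ∫ x in (0 : ℝ)..1, -(-lam (1 - x))⁻¹ = ∫ x in (0 : ℝ)..1, (lam x)⁻¹ := by
    simp only [inv_neg, neg_neg]
    rw [intervalIntegral.integral_comp_sub_left (fun x => (lam x)⁻¹)]
    norm_num
  rw [← hint, ← h]
  ext s
  refine and_congr_right fun _ => ⟨?_, ?_⟩
  · rintro ⟨χ, h0, h1, hχ⟩
    refine ⟨fun r => 1 - χ r, by simp [h0], by simp [h1], fun r hr => ⟨hrefl _ (hχ r hr).1, ?_⟩⟩
    have := (hχ r hr).2.const_sub 1
    simpa using this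
  · rintro ⟨χ, h0, h1, hχ⟩
    refine ⟨fun r => 1 - χ r, by simp [h0], by simp [h1], fun r hr => ⟨hrefl _ (hχ r hr).1, ?_⟩⟩
    have := (hχ r hr).2.const_sub 1
    simpa using this

/-- The times `T_k(Λ)`: a component of negative speed travels from `0` to `1`, a component of
positive speed travels from `1` to `0`. -/
def travelTime {p m : ℕ} (lam : Fin p ⊕ Fin m → ℝ → ℝ) : Fin p ⊕ Fin m → ℝ
  | Sum.inl i => exitTime (lam (Sum.inl i)) 0 1
  | Sum.inr j => exitTime (lam (Sum.inr j)) 1 0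

/-- The diagonal entries of `Λ` are Lipschitz continuous on `[0,1]`. -/
def IsLipschitzDiag {p m : ℕ} (lam : Fin p ⊕ Fin m → ℝ → ℝ) : Prop :=
  ∀ k, ∃ K : NNReal, LipschitzOnWith K (lam k) (Icc 0 1)

/-- `lam_1 ≤ ⋯ ≤ lam_p < 0 < lam_{p+1} ≤ ⋯ ≤ lam_{p+m}` on `[0,1]`. -/
def IsOrderedSpeeds {p m : ℕ} (lam : Fin p ⊕ Fin m → ℝ → ℝ) : Prop :=
  ∀ x ∈ Icc (0 : ℝ) 1,
    (∀ i i' : Fin p, i ≤ i' → lam (Sum.inl i) x ≤ lam (Sum.inl i') x) ∧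
    (∀ i : Fin p, lam (Sum.inl i) x < 0) ∧
    (∀ j : Fin m, 0 < lam (Sum.inr j) x) ∧
    (∀ j j' : Fin m, j ≤ j' → lam (Sum.inr j) x ≤ lam (Sum.inr j') x)

/-- The state space `L²(0,1)^n`, `n = p + m`; the components `Sum.inl` form `y₊`, the components
`Sum.inr` form `y₋`. -/
abbrev StateSpace (p m : ℕ) : Type :=
  PiLp 2 (fun _ : Fin p ⊕ Fin m => Lp ℝ 2 (volume.restrict (Ioo (0 : ℝ) 1)))

/-- The space of controls `L²(0,+∞)^m`. -/
abbrev ControlSpace (m : ℕ) : Type :=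
  PiLp 2 (fun _ : Fin m => Lp ℝ 2 (volume.restrict (Ioi (0 : ℝ))))

/-- The matrix `R = -Λ₊(0) Q Λ₋(0)⁻¹`. -/
def adjointBoundaryMatrix {p m : ℕ} (lam : Fin p ⊕ Fin m → ℝ → ℝ)
    (Q : Matrix (Fin p) (Fin m) ℝ) : Matrix (Fin p) (Fin m) ℝ :=
  -(Matrix.diagonal (fun i => lam (Sum.inl i) 0) * Q *
      Matrix.diagonal (fun j => (lam (Sum.inr j) 0)⁻¹))

/-- Test functions on `[0,T] × [0,1]`: `φ ∈ C¹([0,T] × [0,1])^n` with `φ₊(⬝,1) = 0` and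
`φ₋(⬝,0) = R* φ₊(⬝,0)`. -/
structure IsTestFunction {p m : ℕ} (lam : Fin p ⊕ Fin m → ℝ → ℝ)
    (Q : Matrix (Fin p) (Fin m) ℝ) (T : ℝ) (φ : Fin p ⊕ Fin m → ℝ × ℝ → ℝ) : Prop where
  contDiffOn : ∀ k, ContDiffOn ℝ 1 (φ k) (Icc 0 T ×ˢ Icc 0 1)
  right_eq : ∀ t ∈ Icc 0 T, ∀ i : Fin p, φ (Sum.inl i) (t, 1) = 0
  left_eq : ∀ t ∈ Icc 0 T, ∀ j : Fin m, φ (Sum.inr j) (t, 0) =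
    (adjointBoundaryMatrix lam Q).transpose.mulVec (fun i => φ (Sum.inl i) (t, 0)) j

/-- `y` is the (weak) solution in `C⁰([0,+∞); L²(0,1)^n)` of
`∂ₜ y = Λ ∂ₓ y`, `y₊(t,0) = Q y₋(t,0)`, `y₋(t,1) = u(t)`, `y(0,⬝) = y0`. -/
def IsWeakSolution {p m : ℕ} (lam : Fin p ⊕ Fin m → ℝ → ℝ) (Q : Matrix (Fin p) (Fin m) ℝ)
    (y0 : StateSpace p m) (u : ControlSpace m) (y : ℝ → StateSpace p m) : Prop :=
  ContinuousOn y (Ici 0) ∧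
  ∀ T : ℝ, 0 < T → ∀ φ : Fin p ⊕ Fin m → ℝ × ℝ → ℝ, IsTestFunction lam Q T φ →
    (∫ x in Ioo (0 : ℝ) 1, ∑ k, y T k x * φ k (T, x))
      - (∫ x in Ioo (0 : ℝ) 1, ∑ k, y0 k x * φ k (0, x))
    = (∫ t in Ioo (0 : ℝ) T, ∫ x in Ioo (0 : ℝ) 1, ∑ k, y t k x *
          (deriv (fun s => φ k (s, x)) t - lam k x * deriv (fun ξ => φ k (t, ξ)) x
            - deriv (lam k) x * φ k (t, x)))
      + ∫ t in Ioo (0 : ℝ) T, ∑ j : Fin m,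
          u j t * (lam (Sum.inr j) 1 * φ (Sum.inr j) (t, 1))

/-- Exact controllability in time `T`: every initial state can be steered to every final state
by an `L²` control. -/
def IsExactlyControllable {p m : ℕ} (lam : Fin p ⊕ Fin m → ℝ → ℝ)
    (Q : Matrix (Fin p) (Fin m) ℝ) (T : ℝ) : Prop :=
  ∀ y0 y1 : StateSpace p m, ∃ u : ControlSpace m, ∃ y : ℝ → StateSpace p m,
    IsWeakSolution lam Q y0 u y ∧ y T = y1

/-- `c` is the list of column indices that shows that `Q0` is in canonical form. -/
def IsCanonicalIndices {p m : ℕ} (Q0 : Matrix (Fin p) (Fin m) ℝ) (c : Fin p → Fin m) : Prop :=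
  Function.Injective c ∧ ∀ i,
    Q0 i (c i) ≠ 0 ∧
    (∀ j, c i < j → (∀ k, i < k → j ≠ c k) → Q0 i j = 0) ∧
    (∀ j, j < c i → Q0 i j = 0)

/-- `Q0` is in canonical form. -/
def IsCanonical {p m : ℕ} (Q0 : Matrix (Fin p) (Fin m) ℝ) : Prop :=
  ∃ c : Fin p → Fin m, IsCanonicalIndices Q0 c

/-- Lower triangular with only ones on the diagonal. -/
def IsUnitLower {m : ℕ} (L : Matrix (Fin m) (Fin m) ℝ) : Prop :=
  (∀ i j, i < j → L i j = 0) ∧ ∀ i, L i i = 1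

/-- `Q0` is a canonical form of `Q`. -/
def IsCanonicalFormOf {p m : ℕ} (Q Q0 : Matrix (Fin p) (Fin m) ℝ) : Prop :=
  (∃ L : Matrix (Fin m) (Fin m) ℝ, IsUnitLower L ∧ Q * L = Q0) ∧ IsCanonical Q0

theorem IsUnitLower.mul {m : ℕ} {A B : Matrix (Fin m) (Fin m) ℝ} (hA : IsUnitLower A)
    (hB : IsUnitLower B) : IsUnitLower (A * B) := by
  refine ⟨fun i j hij => ?_, fun i => ?_⟩
  · rw [Matrix.mul_apply]
    refine Finset.sum_eq_zero fun k _ => ?_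
    rcases lt_or_ge i k with h | h
    · rw [hA.1 i k h, zero_mul]
    · rw [hB.1 k j (lt_of_le_of_lt h hij), mul_zero]
  · rw [Matrix.mul_apply, Finset.sum_eq_single i]
    · rw [hA.2, hB.2, one_mul]
    · intro k _ hk
      rcases lt_or_gt_of_ne hk with h | h
      · rw [hB.1 k i h, mul_zero]
      · rw [hA.1 i k h, zero_mul]
    · intro h; exact absurd (Finset.mem_univ i) h

theorem IsUnitLower.blockTriangular {m : ℕ} {A : Matrix (Fin m) (Fin m) ℝ}
    (hA : IsUnitLower A) : A.BlockTriangular OrderDual.toDual :=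
  fun i j hij => hA.1 i j hij

theorem IsUnitLower.det {m : ℕ} {A : Matrix (Fin m) (Fin m) ℝ} (hA : IsUnitLower A) :
    A.det = 1 := by
  rw [Matrix.det_of_isLowerTriangular A hA.blockTriangular]
  exact Finset.prod_eq_one fun i _ => hA.2 i

theorem IsUnitLower.inv {m : ℕ} {A : Matrix (Fin m) (Fin m) ℝ} (hA : IsUnitLower A) :
    IsUnitLower A⁻¹ := by
  have hdet : IsUnit A.det := by rw [hA.det]; exact isUnit_one
  have : Invertible A := Matrix.invertibleOfIsUnitDet A hdet
  have hlow : ∀ i j, i < j → A⁻¹ i j = 0 := fun i j hij =>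
    Matrix.blockTriangular_inv_of_blockTriangular hA.blockTriangular hij
  refine ⟨hlow, fun i => ?_⟩
  have h := congrFun (congrFun (Matrix.nonsing_inv_mul A hdet) i) i
  rw [Matrix.mul_apply, Finset.sum_eq_single i, hA.2, mul_one, Matrix.one_apply_eq] at h
  · exact h
  · intro k _ hk
    rcases lt_or_gt_of_ne hk with h' | h'
    · rw [hA.1 k i h', mul_zero]
    · rw [hlow i k h', zero_mul]
  · intro h'; exact absurd (Finset.mem_univ i) h'

/-- Gaussian elimination: a matrix with independent rows has a canonical form. -/
theorem exists_canonical_aux {m : ℕ} : ∀ (p : ℕ) (Q : Matrix (Fin p) (Fin m) ℝ),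
    LinearIndependent ℝ Q.row →
    ∃ L : Matrix (Fin m) (Fin m) ℝ, IsUnitLower L ∧ IsCanonical (Q * L) := by
  intro p
  induction p with
  | zero =>
    intro Q _
    exact ⟨1, ⟨fun i j h => Matrix.one_apply_ne h.ne, fun i => Matrix.one_apply_eq i⟩,
      Fin.elim0, fun i => i.elim0, fun i => i.elim0⟩
  | succ p ih =>
    intro Q hQ
    obtain ⟨L, hL, c, hc, hcan⟩ := ih (Q.submatrix Fin.succ id)
      (hQ.comp Fin.succ (Fin.succ_injective p))
    set A : Matrix (Fin (p + 1)) (Fin m) ℝ := Q * L with hA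
    have hAs : ∀ (i : Fin p) j, A i.succ j = (Q.submatrix Fin.succ id * L) i j :=
      fun i j => rfl
    have hAdet : IsUnit L.det := by rw [hL.det]; exact isUnit_one
    have hArow : LinearIndependent ℝ A.row := by
      have : Function.Injective (Matrix.vecMulLinear L) := by
        intro v w hvw
        exact Matrix.vecMul_injective_of_isUnit ((Matrix.isUnit_iff_isUnit_det L).2 hAdet) hvw
      have h2 := hQ.map' (Matrix.vecMulLinear L) (LinearMap.ker_eq_bot.2 this)
      have h3 : A.row = Matrix.vecMulLinear L ∘ Q.row := by
        funext i j
        rfl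
      rw [h3]
      exact h2
    have hzero : ∀ (i : Fin p) j, (∀ k, j ≠ c k) → A i.succ j = 0 := by
      intro i j hj
      rw [hAs]
      rcases lt_trichotomy j (c i) with h | h | h
      · exact (hcan i).2.2 j h
      · exact absurd h (hj i)
      · exact (hcan i).2.1 j h fun k _ => hj k
    -- a nonzero entry of the first row outside the previous pivot columns
    have hex : ∃ j, (∀ k, j ≠ c k) ∧ A 0 j ≠ 0 := by
      by_contra hcon
      push Not at hcon
      have hall : ∀ i j, (∀ k, j ≠ c k) → A i j = 0 := by
        intro i j hj
        induction i using Fin.cases with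
        | zero => exact hcon j hj
        | succ i => exact hzero i j hj
      have hsub : LinearIndependent ℝ (fun i => fun k : Fin p => A i (c k)) := by
        rw [Fintype.linearIndependent_iff] at hArow ⊢
        intro g hg
        refine hArow g ?_
        funext j
        by_cases hj : ∀ k, j ≠ c k
        · simp only [Finset.sum_apply, Pi.smul_apply, smul_eq_mul, Pi.zero_apply]
          exact Finset.sum_eq_zero fun i _ => by
            rw [show A.row i j = A i j from rfl, hall i j hj, mul_zero]
        · push Not at hj
          obtain ⟨k, rfl⟩ := hj
          have := congrFun hg k
          simpa [Finset.sum_apply] using this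
      have := hsub.fintype_card_le_finrank
      simp at this
    -- the last such entry
    obtain ⟨j0, ⟨hj0, hj0'⟩, hmax⟩ : ∃ j0, ((∀ k, j0 ≠ c k) ∧ A 0 j0 ≠ 0) ∧
        ∀ j, j0 < j → (∀ k, j ≠ c k) → A 0 j = 0 := by
      classical
      obtain ⟨j1, h1⟩ := hex
      let S := Finset.univ.filter fun j => (∀ k, j ≠ c k) ∧ A 0 j ≠ 0
      have hS : S.Nonempty := ⟨j1, by simpa [S] using h1⟩
      have hm := S.max'_mem hS
      refine ⟨S.max' hS, by simpa [S] using hm, fun j hj hjc => ?_⟩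
      by_contra hne
      have : j ∈ S := by
        simp only [S, Finset.mem_filter, Finset.mem_univ, true_and]
        exact ⟨hjc, hne⟩
      exact absurd (S.le_max' j this) (not_le.2 hj)
    -- removal of the entries to the left of the pivot
    let E : Matrix (Fin m) (Fin m) ℝ := fun i j =>
      if i = j then 1 else if i = j0 ∧ j < j0 then -(A 0 j) / A 0 j0 else 0
    have hE : IsUnitLower E := by
      refine ⟨fun i j hij => ?_, fun i => by simp [E]⟩
      have h1 : i ≠ j := hij.ne
      have h2 : ¬(i = j0 ∧ j < j0) := fun h => absurd (h.1 ▸ h.2) (not_lt.2 hij.le)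
      simp [E, h1, h2]
    have hmul : ∀ i j, (A * E) i j =
        A i j + if j < j0 then A i j0 * (-(A 0 j) / A 0 j0) else 0 := by
      intro i j
      rw [Matrix.mul_apply]
      have : ∀ k, A i k * E k j = (if k = j then A i j else 0) +
          (if k = j0 then (if j < j0 then A i j0 * (-(A 0 j) / A 0 j0) else 0) else 0) := by
        intro k
        by_cases h1 : k = j
        · subst h1
          by_cases h2 : k = j0
          · subst h2; simp [E]
          · simp [E, h2]
        · by_cases h2 : k = j0
          · subst h2
            by_cases h3 : j < k <;> simp [E, h1, h3]
          · simp [E, h1, h2]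
      simp_rw [this]
      rw [Finset.sum_add_distrib]
      simp
    have hAEs : ∀ (i : Fin p) j, (A * E) i.succ j = A i.succ j := by
      intro i j
      rw [hmul, hzero i j0 hj0]
      simp
    refine ⟨L * E, hL.mul hE, Fin.cons j0 c, ?_, ?_⟩
    · rw [Fin.cons_injective_iff]
      exact ⟨fun ⟨k, hk⟩ => hj0 k hk.symm, hc⟩
    · rw [← Matrix.mul_assoc, ← hA]
      intro i
      induction i using Fin.cases with
      | zero =>
        refine ⟨?_, ?_, ?_⟩
        · simpa [hmul] using hj0'
        · intro j hj hjk
          rw [Fin.cons_zero] at hj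
          rw [hmul, if_neg (not_lt.2 hj.le), add_zero]
          exact hmax j hj fun k => by simpa using hjk k.succ (Fin.succ_pos k)
        · intro j hj
          rw [Fin.cons_zero] at hj
          rw [hmul, if_pos hj]
          field_simp
          ring
      | succ i =>
        refine ⟨?_, ?_, ?_⟩
        · rw [hAEs, hAs, Fin.cons_succ]
          exact (hcan i).1
        · intro j hj hjk
          rw [Fin.cons_succ] at hj
          rw [hAEs, hAs]
          exact (hcan i).2.1 j hj fun k hk => by
            simpa using hjk k.succ (Fin.succ_lt_succ_iff.2 hk)
        · intro j hj
          rw [Fin.cons_succ] at hj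
          rw [hAEs, hAs]
          exact (hcan i).2.2 j hj

/-- The common part of the uniqueness arguments: if the pivots agree from row `i0` on, then `L`
vanishes at the rows of these pivots, below the diagonal. -/
theorem canonical_unique_aux {p m : ℕ} {A B : Matrix (Fin p) (Fin m) ℝ}
    {L : Matrix (Fin m) (Fin m) ℝ} {c d : Fin p → Fin m} (hL : IsUnitLower L)
    (hA : IsCanonicalIndices A c) (hB : IsCanonicalIndices B d) (h : A = B * L)
    {P : Fin p → Prop} (hP : ∀ k r, P k → k < r → P r) (hcd : ∀ k, P k → c k = d k)
    (j : Fin m) : ∀ k, P k → j < d k → L (d k) j = 0 := by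
  intro k
  induction k using WellFoundedGT.induction with
  | ind k ih =>
    intro hk hj
    have hAk : A k j = 0 := (hA.2 k).2.2 j (by rw [hcd k hk]; exact hj)
    rw [h, Matrix.mul_apply, Finset.sum_eq_single (d k)] at hAk
    · exact (mul_eq_zero.1 hAk).resolve_left (hB.2 k).1
    · intro l _ hl
      by_cases hl' : ∃ r, k < r ∧ l = d r
      · obtain ⟨r, hkr, rfl⟩ := hl'
        rcases lt_trichotomy j (d r) with h1 | h1 | h1
        · rw [ih r hkr (hP k r hk hkr) h1, mul_zero]
        · rw [(hB.2 k).2.2 (d r) (h1 ▸ hj), zero_mul]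
        · rw [hL.1 _ _ h1, mul_zero]
      · push Not at hl'
        rcases lt_or_gt_of_ne hl with h1 | h1
        · rw [(hB.2 k).2.2 l h1, zero_mul]
        · rw [(hB.2 k).2.1 l h1 hl', zero_mul]
    · intro h'; exact absurd (Finset.mem_univ _) h'

theorem canonicalIndices_unique {p m : ℕ} {A B : Matrix (Fin p) (Fin m) ℝ}
    {L : Matrix (Fin m) (Fin m) ℝ} {c d : Fin p → Fin m} (hL : IsUnitLower L)
    (hA : IsCanonicalIndices A c) (hB : IsCanonicalIndices B d) (h : A = B * L) : c = d := by
  funext i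
  induction i using WellFoundedGT.induction with
  | ind i ih =>
    have key := canonical_unique_aux (P := fun k => i < k) hL hA hB h
      (fun k r hk hkr => lt_trans hk hkr) ih
    rcases lt_trichotomy (c i) (d i) with hlt | heq | hgt
    · exfalso
      have h0 : A i (d i) = 0 := (hA.2 i).2.1 _ hlt fun k hk hcon => by
        rw [ih k hk] at hcon
        exact hk.ne (hB.1 hcon)
      rw [h, Matrix.mul_apply, Finset.sum_eq_single (d i), hL.2, mul_one] at h0
      · exact (hB.2 i).1 h0
      · intro l _ hl
        rcases lt_or_gt_of_ne hl with h1 | h1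
        · rw [hL.1 _ _ h1, mul_zero]
        · by_cases hl' : ∃ r, i < r ∧ l = d r
          · obtain ⟨r, hr, rfl⟩ := hl'
            rw [key _ r hr h1, mul_zero]
          · push Not at hl'
            rw [(hB.2 i).2.1 l h1 hl', zero_mul]
      · intro h'; exact absurd (Finset.mem_univ _) h'
    · exact heq
    · exfalso
      refine (hA.2 i).1 ?_
      rw [h, Matrix.mul_apply]
      refine Finset.sum_eq_zero fun l _ => ?_
      rcases lt_or_ge l (c i) with h1 | h1
      · rw [hL.1 _ _ h1, mul_zero]
      · by_cases hl' : ∃ r, i < r ∧ l = d r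
        · obtain ⟨r, hr, rfl⟩ := hl'
          have h2 : c i < d r := lt_of_le_of_ne h1 fun hcon => by
            rw [← ih r hr] at hcon
            exact hr.ne (hA.1 hcon)
          rw [key _ r hr h2, mul_zero]
        · push Not at hl'
          rw [(hB.2 i).2.1 l (lt_of_lt_of_le hgt h1) hl', zero_mul]

/-- Every matrix with full row rank has exactly one canonical form. -/
theorem existsUnique_canonicalForm {p m : ℕ} (Q : Matrix (Fin p) (Fin m) ℝ) (hQ : Q.rank = p) :
    ∃! Q0, IsCanonicalFormOf Q Q0 := by
  have hrow : LinearIndependent ℝ Q.row := by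
    rw [linearIndependent_iff_card_eq_finrank_span, Set.finrank, ← Matrix.rank_eq_finrank_span_row, hQ,
      Fintype.card_fin]
  obtain ⟨L, hL, hcan⟩ := exists_canonical_aux p Q hrow
  refine ⟨Q * L, ⟨⟨L, hL, rfl⟩, hcan⟩, ?_⟩
  rintro A ⟨⟨M, hM, rfl⟩, c, hc⟩
  obtain ⟨d, hd⟩ := hcan
  have hdet : IsUnit L.det := by rw [hL.det]; exact isUnit_one
  have h : Q * M = Q * L * (L⁻¹ * M) := by
    rw [Matrix.mul_assoc, ← Matrix.mul_assoc L, Matrix.mul_nonsing_inv L hdet, Matrix.one_mul]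
  have hN : IsUnitLower (L⁻¹ * M) := hL.inv.mul hM
  have hcd := canonicalIndices_unique hN hc hd h
  have key := canonical_unique_aux (P := fun _ => True) hN hc hd h (fun _ _ _ _ => trivial)
    (fun k _ => congrFun hcd k)
  ext i j
  rw [h, Matrix.mul_apply, Finset.sum_eq_single j, hN.2, mul_one]
  · intro l _ hl
    rcases lt_or_gt_of_ne hl with h1 | h1
    · rw [hN.1 _ _ h1, mul_zero]
    · by_cases hl' : ∃ r, l = d r
      · obtain ⟨r, rfl⟩ := hl'
        rw [key _ r trivial h1, mul_zero]
      · push Not at hl'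
        rcases lt_or_gt_of_ne (hl' i) with h2 | h2
        · rw [(hd.2 i).2.2 l h2, zero_mul]
        · rw [(hd.2 i).2.1 l h2 fun k _ => hl' k, zero_mul]
  · intro h'; exact absurd (Finset.mem_univ _) h'

/-- The canonical form `Q⁰` of a matrix `Q` with full row rank. -/
def canonicalForm {p m : ℕ} (Q : Matrix (Fin p) (Fin m) ℝ) (hQ : Q.rank = p) :
    Matrix (Fin p) (Fin m) ℝ :=
  (existsUnique_canonicalForm Q hQ).choose

/-- The indices `c_i(Q) = c_i(Q⁰)` of a matrix `Q` with full row rank. -/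
def canonicalIndex {p m : ℕ} (Q : Matrix (Fin p) (Fin m) ℝ) (hQ : Q.rank = p) : Fin p → Fin m :=
  (existsUnique_canonicalForm Q hQ).choose_spec.1.2.choose

/-- The time `max_{1 ≤ i ≤ p} (T_{p+1}(Λ), T_i(Λ) + T_{p+c_i(Q)}(Λ))`. -/
def controlTime {p m : ℕ} [NeZero p] [NeZero m] (lam : Fin p ⊕ Fin m → ℝ → ℝ)
    (Q : Matrix (Fin p) (Fin m) ℝ) (hQ : Q.rank = p) : ℝ :=
  Finset.univ.sup' Finset.univ_nonempty fun i : Fin p =>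
    max (travelTime lam (Sum.inr 0))
      (travelTime lam (Sum.inl i) + travelTime lam (Sum.inr (canonicalIndex Q hQ i)))

end

end HyperbolicControl

/-! Characteristics reduce the system to finite-dimensional algebra at the boundary `x = 0`. Put
`σ_k(x) = ∫₀ˣ 1/λ_k`. Every component has the form `y_k(t,x) = w_k(t + σ_k(x))`, so `w_k(t)` is its
trace at `x = 0`, the boundary condition reads `w₊(t) = Q w₋(t)` for `t > 0`, and the control is the
trace `w₋,j(t + T_{p+j})` at `x = 1`. The initial state fixes `w₋,j` on `(0, T_{p+j})` and `w_i` on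
`(-T_i, 0)`; the final state asks for `w₋,j` on `(T, T + T_{p+j})` and `w_i` on `(T - T_i, T)`. The
remaining values of `w₋` are free.

Sufficiency. At a time `s` in `(0,T)` the components of `w₋` with `T_{p+j} > s` are given and the
rows of `Q w₋` with `T_i > T - s` are prescribed. Since travel times are ordered, the free columns
and the prescribed rows are final segments, and the hypothesis on `T` says that the pivot column of
each prescribed row is free. The canonical form then makes the linear system solvable
(`exists_prescribed`). As only finitely many such systems occur, the solution can be chosen
measurable and bounded in `s` (`exists_selection`), so that the profiles stay in `L²`.
`IsSpeed.transport` shows that they give a weak solution.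

Necessity. If an inequality or the rank condition fails, some combination of traces is already
determined by the initial state while the final state prescribes it. In dual form this is a nonzero
adjoint solution `f_k(t + σ_k(x)) / λ_k(x)` that vanishes at `x = 1`, hence is not seen by the
control; solutions from rest are orthogonal to it at time `T`
(`IsHiddenFamily.sum_integral_eq_zero`), so not every final state is reached. A smooth bump times a
constant vector is enough; the vector comes from `exists_annihilator` or from a dependence between
the rows of `Q`. As `λ_k` is only Lipschitz, the adjoint solution need not be `C¹`, and `1/λ_k` has
to be approximated before testing (`IsSpeed.exists_inv_approx`). -/

namespace HyperbolicControl

/-! ### Phases of speeds and composition of functions with them -/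

/-- A speed on the whole line: Lipschitz, bounded, and bounded away from zero. -/
structure IsSpeed (l : ℝ → ℝ) : Prop where
  lip : ∃ K, LipschitzWith K l
  lower : ∃ c > 0, ∀ x, c ≤ |l x|
  upper : ∃ C, ∀ x, |l x| ≤ C

/-- The phase `x ↦ ∫₀ˣ 1 / l`: every solution of `∂ₜ y = l ∂ₓ y` is a function of
`t + phase l x`. -/
noncomputable def phase (l : ℝ → ℝ) (x : ℝ) : ℝ := ∫ s in (0 : ℝ)..x, (l s)⁻¹

namespace IsSpeed

variable {l : ℝ → ℝ}

theorem continuous (hl : IsSpeed l) : Continuous l := hl.lip.choose_spec.continuous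

theorem ne_zero (hl : IsSpeed l) (x : ℝ) : l x ≠ 0 := by
  obtain ⟨c, hc, h⟩ := hl.lower
  exact abs_pos.1 (hc.trans_le (h x))

theorem continuous_inv (hl : IsSpeed l) : Continuous fun x => (l x)⁻¹ :=
  hl.continuous.inv₀ hl.ne_zero

theorem hasDerivAt_phase (hl : IsSpeed l) (x : ℝ) : HasDerivAt (phase l) (l x)⁻¹ x :=
  (hl.continuous_inv.integral_hasStrictDerivAt 0 x).hasDerivAt

theorem contDiff_phase (hl : IsSpeed l) : ContDiff ℝ 1 (phase l) := by
  rw [contDiff_one_iff_deriv]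
  refine ⟨fun x => (hl.hasDerivAt_phase x).differentiableAt, ?_⟩
  rw [show deriv (phase l) = fun x => (l x)⁻¹ from funext fun x => (hl.hasDerivAt_phase x).deriv]
  exact hl.continuous_inv

theorem continuous_phase (hl : IsSpeed l) : Continuous (phase l) := hl.contDiff_phase.continuous

theorem injective_phase (hl : IsSpeed l) : Function.Injective (phase l) := by
  have key : ∀ a b, a < b → phase l a ≠ phase l b := by
    intro a b hab h
    obtain ⟨x, -, hx⟩ := exists_hasDerivAt_eq_zero hab hl.continuous_phase.continuousOn h
      fun x _ => hl.hasDerivAt_phase x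
    exact inv_ne_zero (hl.ne_zero x) hx
  intro a b h
  rcases lt_trichotomy a b with h1 | h1 | h1
  · exact absurd h (key a b h1)
  · exact h1
  · exact absurd h.symm (key b a h1)

theorem measurableEmbedding_phase (hl : IsSpeed l) : MeasurableEmbedding (phase l) :=
  hl.continuous_phase.measurableEmbedding hl.injective_phase

/-- Change of variables: the image measure has density `|l|` on the range of the translated phase.
Uniformity in `t` is what makes the later bounds uniform in time. -/
theorem exists_map_le (hl : IsSpeed l) : ∃ C : NNReal, ∀ t,
    (volume : Measure ℝ).map (fun x => t + phase l x) ≤ C • volume := by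
  obtain ⟨C, hC⟩ := hl.upper
  refine ⟨C.toNNReal, fun t => ?_⟩
  have hC0 : 0 ≤ C := (abs_nonneg _).trans (hC 0)
  have hm : Measurable fun x => t + phase l x := (hl.continuous_phase.measurable).const_add t
  refine Measure.le_iff.2 fun s hs => ?_
  rw [Measure.map_apply hm hs, Measure.smul_apply]
  have h1 := lintegral_image_eq_lintegral_abs_deriv_mul
    (f := fun x => t + phase l x) (hm hs)
    (fun x _ => ((hl.hasDerivAt_phase x).const_add t).hasDerivWithinAt)
    (fun a _ b _ h => hl.injective_phase (add_left_cancel h)) (fun _ => 1)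
  have h2 : (fun x => t + phase l x) '' ((fun x => t + phase l x) ⁻¹' s) ⊆ s :=
    image_preimage_subset _ _
  simp only [lintegral_const, mul_one, one_mul, Measure.restrict_apply MeasurableSet.univ,
    univ_inter] at h1
  calc volume ((fun x => t + phase l x) ⁻¹' s)
      = ∫⁻ x in (fun x => t + phase l x) ⁻¹' s, 1 := by simp
    _ ≤ ∫⁻ x in (fun x => t + phase l x) ⁻¹' s,
          ENNReal.ofReal C * ENNReal.ofReal |(l x)⁻¹| := by
        refine lintegral_mono fun x => ?_
        rw [← ENNReal.ofReal_mul hC0, ENNReal.one_le_ofReal, abs_inv, ← div_eq_mul_inv,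
          one_le_div (abs_pos.2 (hl.ne_zero x))]
        exact hC x
    _ = ENNReal.ofReal C * ∫⁻ x in (fun x => t + phase l x) ⁻¹' s,
          ENNReal.ofReal |(l x)⁻¹| := by
        rw [lintegral_const_mul' _ _ ENNReal.ofReal_ne_top]
    _ ≤ ENNReal.ofReal C * volume s := by
        rw [← h1]
        gcongr
    _ = _ := rfl

theorem exists_eLpNorm_comp_le (hl : IsSpeed l) (p : ENNReal) (hp : 1 ≤ p) : ∃ C : NNReal,
    ∀ (w : ℝ → ℝ) (t : ℝ), Measurable w →
      eLpNorm (fun x => w (t + phase l x)) p (volume.restrict (Ioo 0 1)) ≤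
        C * eLpNorm w p volume := by
  obtain ⟨C, hC⟩ := hl.exists_map_le
  -- The constant is made at least `1`, so that it dominates its power `1 / p` for every `p ≥ 1`,
  -- including `p = ∞`.
  refine ⟨(C + 1), fun w t hw => ?_⟩
  have hm : Measurable fun x => t + phase l x := (hl.continuous_phase.measurable).const_add t
  calc eLpNorm (fun x => w (t + phase l x)) p (volume.restrict (Ioo 0 1))
      ≤ eLpNorm (fun x => w (t + phase l x)) p volume :=
        eLpNorm_mono_measure _ Measure.restrict_le_self
    _ = eLpNorm w p (volume.map (fun x => t + phase l x)) :=
        (eLpNorm_map_measure hw.aestronglyMeasurable hm.aemeasurable).symm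
    _ ≤ eLpNorm w p ((C + 1 : NNReal) • volume) := by
        refine eLpNorm_mono_measure _ ((hC t).trans ?_)
        refine Measure.le_iff.2 fun s _ => ?_
        rw [Measure.smul_apply, Measure.smul_apply]
        exact mul_le_mul_left (by exact_mod_cast (le_add_of_nonneg_right zero_le_one : C ≤ C + 1)) _
    _ ≤ _ := by
        rw [show ((C + 1 : NNReal) • volume : Measure ℝ) = ((C + 1 : NNReal) : ENNReal) • volume
          from rfl, eLpNorm_smul_measure_of_ne_zero (by positivity), smul_eq_mul]
        gcongr
        have h1 : (1 : ENNReal) ≤ ((C + 1 : NNReal) : ENNReal) := by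
          exact_mod_cast (le_add_of_nonneg_left (zero_le) : 1 ≤ C + 1)
        refine (ENNReal.rpow_le_rpow_of_exponent_le h1 ?_).trans (ENNReal.rpow_one _).le
        rw [one_div, ENNReal.toReal_inv]
        rcases eq_or_ne p ⊤ with rfl | hp'
        · simp
        · exact inv_le_one_of_one_le₀ (by
            simpa using (ENNReal.toReal_le_toReal ENNReal.one_ne_top hp').2 hp)

theorem memLp_comp (hl : IsSpeed l) {p : ENNReal} (hp : 1 ≤ p) {w : ℝ → ℝ} (hw : Measurable w)
    (hw' : MemLp w p volume) (t : ℝ) :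
    MemLp (fun x => w (t + phase l x)) p (volume.restrict (Ioo 0 1)) := by
  obtain ⟨C, hC⟩ := hl.exists_eLpNorm_comp_le p hp
  refine ⟨(hw.comp ((hl.continuous_phase.measurable).const_add t)).aestronglyMeasurable, ?_⟩
  exact (hC w t hw).trans_lt (ENNReal.mul_lt_top ENNReal.coe_lt_top hw'.2)

/-- Translations act continuously on `L²(ℝ)`, and composition with the phase is bounded from `L²(ℝ)`
to `L²(0,1)`. This gives the continuity in time of the solutions built from profiles. -/
theorem continuous_toLp_comp (hl : IsSpeed l) {w : ℝ → ℝ} (hw : Measurable w)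
    (hw' : MemLp w 2 volume) :
    Continuous fun t => (hl.memLp_comp one_le_two hw hw' t).toLp := by
  obtain ⟨C, hC⟩ := hl.exists_eLpNorm_comp_le 2 one_le_two
  have hmp : ∀ t : ℝ, MeasurePreserving (fun s : ℝ => t + s) volume volume :=
    fun t => measurePreserving_add_left volume t
  let W : Lp ℝ 2 (volume : Measure ℝ) := hw'.toLp
  let g : ℝ → C(ℝ, ℝ) := fun t => ⟨fun s => t + s, by fun_prop⟩
  have hg : Continuous g := ContinuousMap.continuous_of_continuous_uncurry g
    (by simp only [g]; exact continuous_fst.add continuous_snd)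
  have hcont : Continuous fun t => Lp.compMeasurePreserving (g t) (hmp t) W :=
    continuous_const.compMeasurePreservingLp hg hmp (by simp)
  rw [continuous_iff_continuousAt] at hcont ⊢
  intro t0
  have h0 := (hcont t0)
  rw [ContinuousAt, tendsto_iff_edist_tendsto_0] at h0 ⊢
  have h1 := ENNReal.Tendsto.const_mul h0 (Or.inr (ENNReal.coe_ne_top (r := C)))
  rw [mul_zero] at h1
  refine tendsto_of_tendsto_of_tendsto_of_le_of_le tendsto_const_nhds h1 (fun _ => zero_le) ?_
  intro t
  simp only
  rw [Lp.edist_toLp_toLp, Lp.edist_def]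
  have h2 : (⇑(Lp.compMeasurePreserving (g t) (hmp t) W) -
      ⇑(Lp.compMeasurePreserving (g t0) (hmp t0) W)) =ᵐ[volume]
      fun s => w (t + s) - w (t0 + s) := by
    have e : ∀ t, ⇑(Lp.compMeasurePreserving (g t) (hmp t) W) =ᵐ[volume] fun s => w (t + s) :=
      fun t => (Lp.coeFn_compMeasurePreserving W (hmp t)).trans
        ((hmp t).quasiMeasurePreserving.ae_eq_comp hw'.coeFn_toLp)
    exact (e t).sub (e t0)
  rw [eLpNorm_congr_ae h2]
  have h3 := hC (fun s => w (t + s) - w (t0 + s)) 0 (by fun_prop)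
  simp only [zero_add] at h3
  exact h3

theorem exists_restrict_range_le (hl : IsSpeed l) : ∃ C : NNReal,
    volume.restrict (range (phase l)) ≤ C • (volume : Measure ℝ).map (phase l) := by
  obtain ⟨c, hc, hc'⟩ := hl.lower
  have hm : Measurable (phase l) := hl.continuous_phase.measurable
  refine ⟨c⁻¹.toNNReal, Measure.le_iff.2 fun s hs => ?_⟩
  rw [Measure.smul_apply, Measure.map_apply hm hs, Measure.restrict_apply hs,
    ← image_preimage_eq_inter_range]
  have h1 := lintegral_image_eq_lintegral_abs_deriv_mul (hm hs)
    (fun x _ => (hl.hasDerivAt_phase x).hasDerivWithinAt) hl.injective_phase.injOn (fun _ => 1)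
  simp only [lintegral_const, mul_one, one_mul, Measure.restrict_apply MeasurableSet.univ,
    univ_inter] at h1
  rw [h1]
  calc ∫⁻ x in phase l ⁻¹' s, ENNReal.ofReal |(l x)⁻¹|
      ≤ ∫⁻ _ in phase l ⁻¹' s, ENNReal.ofReal c⁻¹ := by
        refine lintegral_mono fun x => ENNReal.ofReal_le_ofReal ?_
        rw [abs_inv]
        exact inv_anti₀ hc (hc' x)
    _ = ENNReal.ofReal c⁻¹ * volume (phase l ⁻¹' s) := by simp
    _ = _ := rfl

/-- Change of variables in the other direction, where the lower bound of `|l|` enters: a function of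
`x` becomes a function of the phase, and zero off its range. -/
theorem memLp_extend (hl : IsSpeed l) {q : ENNReal} {g : ℝ → ℝ} (hg : Measurable g)
    (hg' : MemLp g q volume) : MemLp (Function.extend (phase l) g 0) q volume := by
  have hm : Measurable (Function.extend (phase l) g 0) :=
    hl.measurableEmbedding_phase.measurable_extend hg measurable_const
  have hr : MeasurableSet (range (phase l)) := hl.measurableEmbedding_phase.measurableSet_range
  obtain ⟨C, hC⟩ := hl.exists_restrict_range_le
  have hsub : (range (phase l)).indicator (Function.extend (phase l) g 0) =
      Function.extend (phase l) g 0 := by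
    refine indicator_eq_self.2 fun s hs => ?_
    by_contra hcon
    exact hs (Function.extend_apply' _ _ _ (by simpa using hcon))
  rw [← hsub, memLp_indicator_iff_restrict hr]
  refine MemLp.of_measure_le_smul (c := C) ENNReal.coe_ne_top hC ?_
  rw [memLp_map_measure_iff hm.aestronglyMeasurable hl.continuous_phase.measurable.aemeasurable,
    show Function.extend (phase l) g 0 ∘ phase l = g from
      funext fun x => hl.injective_phase.extend_apply _ _ x]
  exact hg'

end IsSpeed

/-! ### The weak transport equation for travelling profiles -/

/-- `A` and `B` are continuous extensions of the partial derivatives of `Φ` in `(0,S) × (0,1)`. -/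
structure HasPartials (S : ℝ) (Φ A B : ℝ × ℝ → ℝ) : Prop where
  cont : Continuous Φ
  contA : Continuous A
  contB : Continuous B
  derivA : ∀ t ∈ Ioo 0 S, ∀ x ∈ Ioo (0 : ℝ) 1, HasDerivAt (fun s => Φ (s, x)) (A (t, x)) t
  derivB : ∀ t ∈ Ioo 0 S, ∀ x ∈ Ioo (0 : ℝ) 1, HasDerivAt (fun ξ => Φ (t, ξ)) (B (t, x)) x

/-- A test function is controlled only on the closed rectangle. Composing it and its partial
derivatives with the nearest-point projection gives globally continuous and bounded functions; they
are still derivatives of one another inside the rectangle, which is all that the integrals see. -/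
theorem exists_hasPartials {S : ℝ} (hS : 0 < S) {φ : ℝ × ℝ → ℝ}
    (hφ : ContDiffOn ℝ 1 φ (Icc 0 S ×ˢ Icc 0 1)) :
    ∃ Φ A B, HasPartials S Φ A B ∧ (∀ z ∈ Icc 0 S ×ˢ Icc (0 : ℝ) 1, Φ z = φ z) ∧
      (∃ M, ∀ z, |Φ z| ≤ M ∧ |A z| ≤ M ∧ |B z| ≤ M) ∧
      ∀ t ∈ Ioo 0 S, ∀ x ∈ Ioo (0 : ℝ) 1, deriv (fun s => φ (s, x)) t = A (t, x) ∧
        deriv (fun ξ => φ (t, ξ)) x = B (t, x) := by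
  let R : Set (ℝ × ℝ) := Icc 0 S ×ˢ Icc 0 1
  have hR : UniqueDiffOn ℝ R := (uniqueDiffOn_Icc hS).prod (uniqueDiffOn_Icc zero_lt_one)
  let P : ℝ × ℝ → ℝ × ℝ := fun z => (projIcc 0 S hS.le z.1, projIcc 0 1 zero_le_one z.2)
  have hP : Continuous P :=
    ((continuous_subtype_val.comp continuous_projIcc).comp continuous_fst).prodMk
      ((continuous_subtype_val.comp continuous_projIcc).comp continuous_snd)
  have hPR : ∀ z, P z ∈ R := fun z => ⟨(projIcc 0 S hS.le z.1).2, (projIcc 0 1 zero_le_one z.2).2⟩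
  have hPid : ∀ z ∈ R, P z = z := fun z hz => by
    simp only [P]
    rw [projIcc_of_mem _ hz.1, projIcc_of_mem _ hz.2]
  have hD := hφ.continuousOn_fderivWithin hR le_rfl
  have hA : ContinuousOn (fun z => fderivWithin ℝ φ R z (1, 0)) R := hD.clm_apply continuousOn_const
  have hB : ContinuousOn (fun z => fderivWithin ℝ φ R z (0, 1)) R := hD.clm_apply continuousOn_const
  have hcpt : IsCompact R := isCompact_Icc.prod isCompact_Icc
  have hnhds : ∀ t ∈ Ioo 0 S, ∀ x ∈ Ioo (0 : ℝ) 1, R ∈ nhds (t, x) := fun t ht x hx =>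
    prod_mem_nhds (Icc_mem_nhds ht.1 ht.2) (Icc_mem_nhds hx.1 hx.2)
  have hdiff : ∀ t ∈ Ioo 0 S, ∀ x ∈ Ioo (0 : ℝ) 1,
      HasFDerivAt φ (fderivWithin ℝ φ R (t, x)) (t, x) := fun t ht x hx =>
    ((hφ.differentiableOn one_ne_zero _ (mem_of_mem_nhds (hnhds t ht x hx))).hasFDerivWithinAt).hasFDerivAt
      (hnhds t ht x hx)
  have hdA : ∀ t ∈ Ioo 0 S, ∀ x ∈ Ioo (0 : ℝ) 1,
      HasDerivAt (fun s => φ (s, x)) (fderivWithin ℝ φ R (t, x) (1, 0)) t := fun t ht x hx =>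
    (hdiff t ht x hx).comp_hasDerivAt t ((hasDerivAt_id t).prodMk (hasDerivAt_const t x))
  have hdB : ∀ t ∈ Ioo 0 S, ∀ x ∈ Ioo (0 : ℝ) 1,
      HasDerivAt (fun ξ => φ (t, ξ)) (fderivWithin ℝ φ R (t, x) (0, 1)) x := fun t ht x hx =>
    (hdiff t ht x hx).comp_hasDerivAt x ((hasDerivAt_const x t).prodMk (hasDerivAt_id x))
  have hmemR : ∀ t ∈ Ioo 0 S, ∀ x ∈ Ioo (0 : ℝ) 1, ((t, x) : ℝ × ℝ) ∈ R := fun t ht x hx =>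
    ⟨Ioo_subset_Icc_self ht, Ioo_subset_Icc_self hx⟩
  refine ⟨fun z => φ (P z), fun z => fderivWithin ℝ φ R (P z) (1, 0),
    fun z => fderivWithin ℝ φ R (P z) (0, 1), ⟨hφ.continuousOn.comp_continuous hP hPR,
      hA.comp_continuous hP hPR, hB.comp_continuous hP hPR, ?_, ?_⟩, ?_, ?_, ?_⟩
  · intro t ht x hx
    rw [hPid _ (hmemR t ht x hx)]
    refine (hdA t ht x hx).congr_of_eventuallyEq ?_
    filter_upwards [Ioo_mem_nhds ht.1 ht.2] with s hs
    rw [hPid _ (hmemR s hs x hx)]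
  · intro t ht x hx
    rw [hPid _ (hmemR t ht x hx)]
    refine (hdB t ht x hx).congr_of_eventuallyEq ?_
    filter_upwards [Ioo_mem_nhds hx.1 hx.2] with s hs
    rw [hPid _ (hmemR t ht s hs)]
  · intro z hz
    simp only [hPid z hz]
  · obtain ⟨M1, h1⟩ := hcpt.exists_bound_of_continuousOn hφ.continuousOn
    obtain ⟨M2, h2⟩ := hcpt.exists_bound_of_continuousOn hA
    obtain ⟨M3, h3⟩ := hcpt.exists_bound_of_continuousOn hB
    exact ⟨max M1 (max M2 M3), fun z => ⟨(h1 _ (hPR z)).trans (le_max_left _ _),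
      (h2 _ (hPR z)).trans ((le_max_left _ _).trans (le_max_right _ _)),
      (h3 _ (hPR z)).trans ((le_max_right _ _).trans (le_max_right _ _))⟩⟩
  · intro t ht x hx
    simp only [(hdA t ht x hx).deriv, (hdB t ht x hx).deriv, hPid _ (hmemR t ht x hx)]
    exact ⟨trivial, trivial⟩

theorem lipschitzOnWith_of_hasDerivAt_Ioo {f f' : ℝ → ℝ} {a b : ℝ} (hab : a < b)
    (hf : Continuous f) (hf' : Continuous f') (h : ∀ x ∈ Ioo a b, HasDerivAt f (f' x) x) :
    ∃ K, LipschitzOnWith K f (Icc a b) := by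
  obtain ⟨M, hM⟩ := (isCompact_Icc (a := a) (b := b)).exists_bound_of_continuousOn hf'.continuousOn
  refine ⟨M.toNNReal, ?_⟩
  rw [← closure_Ioo hab.ne]
  refine LipschitzOnWith.closure hf.continuousOn ?_
  refine (convex_Ioo a b).lipschitzOnWith_of_nnnorm_hasDerivWithin_le
    (fun x hx => (h x hx).hasDerivWithinAt) fun x hx => ?_
  rw [← NNReal.coe_le_coe, coe_nnnorm]
  exact (hM x (Ioo_subset_Icc_self hx)).trans (Real.le_coe_toNNReal M)

namespace IsSpeed

variable {l : ℝ → ℝ}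

/-- The space integration by parts behind the transport identity, at a fixed time. -/
theorem integral_parts (hl : IsSpeed l) {w f f' : ℝ → ℝ} (hw : ContDiff ℝ 1 w)
    (hf : Continuous f) (hf' : Continuous f')
    (hff' : ∀ x ∈ Ioo (0 : ℝ) 1, HasDerivAt f (f' x) x) (t : ℝ) :
    ∫ x in Ioo (0 : ℝ) 1, (deriv w (t + phase l x) * f x +
        w (t + phase l x) * (deriv l x * f x + l x * f' x)) =
      w (t + phase l 1) * (l 1 * f 1) - w t * (l 0 * f 0) := by
  obtain ⟨K1, h1⟩ := lipschitzOnWith_of_hasDerivAt_Ioo zero_lt_one hf hf' hff'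
  obtain ⟨K2, h2⟩ := hl.lip
  have hwd : ∀ s, HasDerivAt w (deriv w s) s := fun s =>
    (hw.differentiable one_ne_zero s).hasDerivAt
  have hwd' : Continuous (deriv w) := hw.continuous_deriv le_rfl
  have hσ : ∀ x, HasDerivAt (fun x => w (t + phase l x)) (deriv w (t + phase l x) * (l x)⁻¹) x :=
    fun x => (hwd _).comp x ((hl.hasDerivAt_phase x).const_add t)
  have hcomp : Continuous fun x => w (t + phase l x) :=
    hw.continuous.comp (continuous_const.add hl.continuous_phase)
  obtain ⟨K3, h3⟩ := lipschitzOnWith_of_hasDerivAt_Ioo zero_lt_one hcomp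
    ((hwd'.comp (continuous_const.add hl.continuous_phase)).mul hl.continuous_inv)
    fun x _ => hσ x
  -- `l` is only Lipschitz, so the product `w (t + phase l x) * (l x * f x)` need not be
  -- differentiable everywhere; absolute continuity still gives the fundamental theorem of calculus.
  rw [← uIcc_of_le (zero_le_one' ℝ)] at h1 h3
  have hac := h3.absolutelyContinuousOnInterval.fun_mul
    ((h2.lipschitzOnWith (s := uIcc 0 1)).absolutelyContinuousOnInterval.fun_mul
      h1.absolutelyContinuousOnInterval)
  have hint := hac.integral_deriv_eq_sub
  rw [intervalIntegral.integral_of_le zero_le_one, integral_Ioc_eq_integral_Ioo] at hint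
  have hp0 : phase l 0 = 0 := intervalIntegral.integral_same
  rw [hp0, add_zero] at hint
  rw [← hint]
  refine setIntegral_congr_ae measurableSet_Ioo ?_
  -- Where `l` is differentiable, the factor `(l x)⁻¹` from the chain rule cancels the factor `l x`
  -- of the product.
  filter_upwards [h2.ae_differentiableAt_real] with x hx hx'
  have hd := (hσ x).mul (hx.hasDerivAt.mul (hff' x hx'))
  have := hl.ne_zero x
  refine Eq.trans ?_ hd.deriv.symm
  simp only [Pi.mul_apply]
  field_simp

/-- Integrate the time derivative `G` of `w (t + phase l x) * Φ (t, x)` over the rectangle. In time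
first, this gives the terms at `S` and `0`; in space first, `integral_parts` trades the term with
`w'` for the boundary terms and the adjoint operator applied to `Φ`. -/
theorem transport_smooth (hl : IsSpeed l) {S : ℝ} (hS : 0 < S) {Φ A B : ℝ × ℝ → ℝ}
    (hΦ : HasPartials S Φ A B) {w : ℝ → ℝ} (hw : ContDiff ℝ 1 w) :
    (∫ x in Ioo (0 : ℝ) 1, w (S + phase l x) * Φ (S, x))
      - (∫ x in Ioo (0 : ℝ) 1, w (0 + phase l x) * Φ (0, x))
    = (∫ t in Ioo (0 : ℝ) S, ∫ x in Ioo (0 : ℝ) 1, w (t + phase l x) *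
          (A (t, x) - l x * B (t, x) - deriv l x * Φ (t, x)))
      + (∫ t in Ioo (0 : ℝ) S, w (t + phase l 1) * (l 1 * Φ (t, 1)))
      - ∫ t in Ioo (0 : ℝ) S, w t * (l 0 * Φ (t, 0)) := by
  have hwd : ∀ s, HasDerivAt w (deriv w s) s := fun s =>
    (hw.differentiable one_ne_zero s).hasDerivAt
  have hwd' : Continuous (deriv w) := hw.continuous_deriv le_rfl
  have hwc := hw.continuous
  have hpc := hl.continuous_phase
  have hc := hΦ.cont
  have hcA := hΦ.contA
  have hcB := hΦ.contB
  have hlc := hl.continuous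
  obtain ⟨K, hK⟩ := hl.lip
  let G : ℝ × ℝ → ℝ := fun z =>
    deriv w (z.1 + phase l z.2) * Φ z + w (z.1 + phase l z.2) * A z
  have hG : Continuous G := by fun_prop
  have hGint : Integrable G
      ((volume.restrict (Ioo 0 S)).prod (volume.restrict (Ioo (0 : ℝ) 1))) := by
    rw [Measure.prod_restrict]
    exact (hG.continuousOn.integrableOn_compact (isCompact_Icc.prod isCompact_Icc)).mono_set
      (prod_mono Ioo_subset_Icc_self Ioo_subset_Icc_self)
  have hcompact : ∀ {f : ℝ → ℝ} {a b : ℝ}, Continuous f →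
      Integrable f (volume.restrict (Ioo a b)) := fun {f a b} hf =>
    (hf.continuousOn.integrableOn_compact isCompact_Icc).mono_set Ioo_subset_Icc_self
  -- time integration
  have h1 : ∀ x ∈ Ioo (0 : ℝ) 1, ∫ t in Ioo (0 : ℝ) S, G (t, x) =
      w (S + phase l x) * Φ (S, x) - w (0 + phase l x) * Φ (0, x) := by
    intro x hx
    rw [← integral_Ioc_eq_integral_Ioo, ← intervalIntegral.integral_of_le hS.le]
    refine intervalIntegral.integral_eq_sub_of_hasDerivAt_of_le hS.le
      (f := fun t => w (t + phase l x) * Φ (t, x)) (by fun_prop) (fun t ht => ?_)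
      (Continuous.intervalIntegrable (by fun_prop) _ _)
    have h2 : HasDerivAt (fun t => w (t + phase l x)) (deriv w (t + phase l x)) t :=
      (hwd _).comp_add_const t (phase l x)
    exact h2.mul (hΦ.derivA t ht x hx)
  have h2 : ∀ t ∈ Ioo (0 : ℝ) S, ∫ x in Ioo (0 : ℝ) 1, w (t + phase l x) *
          (A (t, x) - l x * B (t, x) - deriv l x * Φ (t, x)) =
      (∫ x in Ioo (0 : ℝ) 1, G (t, x)) -
        (w (t + phase l 1) * (l 1 * Φ (t, 1)) - w t * (l 0 * Φ (t, 0))) := by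
    intro t ht
    rw [← hl.integral_parts hw (f := fun x => Φ (t, x)) (f' := fun x => B (t, x)) (by fun_prop)
      (by fun_prop) (hΦ.derivB t ht) t, ← integral_sub (hcompact (by fun_prop))]
    · refine integral_congr_ae (Filter.Eventually.of_forall fun x => ?_)
      simp only [G]
      ring
    · refine Integrable.add (hcompact (by fun_prop)) ?_
      have h3 : Integrable (fun x => w (t + phase l x) * Φ (t, x)) (volume.restrict (Ioo 0 1)) :=
        hcompact (by fun_prop)
      have h4 : Integrable (fun x => w (t + phase l x) * (l x * B (t, x)))
        (volume.restrict (Ioo 0 1)) := hcompact (by fun_prop)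
      have h5 := (h3.bdd_mul (measurable_deriv l).aestronglyMeasurable (c := K)
        (Filter.Eventually.of_forall fun x => norm_deriv_le_of_lipschitz hK)).add h4
      refine h5.congr (Filter.Eventually.of_forall fun x => ?_)
      simp only [Pi.add_apply]
      ring
  rw [setIntegral_congr_fun measurableSet_Ioo h2, integral_sub hGint.integral_prod_left,
    integral_sub, integral_integral_swap hGint, setIntegral_congr_fun measurableSet_Ioo h1,
    integral_sub]
  · ring
  all_goals try exact hcompact (by fun_prop)

/-- The `L¹` bound behind the passage from smooth to integrable profiles in `transport`. -/
theorem exists_integral_comp_le (hl : IsSpeed l) : ∃ C, 0 ≤ C ∧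
    ∀ (w k : ℝ → ℝ) (M t : ℝ), Measurable w → Integrable w → (∀ x, |k x| ≤ M) →
      |∫ x in Ioo (0 : ℝ) 1, w (t + phase l x) * k x| ≤ C * M * ∫ s, |w s| := by
  obtain ⟨C, hC⟩ := hl.exists_eLpNorm_comp_le 1 le_rfl
  refine ⟨C, C.2, fun w k M t hw hw' hk => ?_⟩
  have hM : 0 ≤ M := (abs_nonneg _).trans (hk 0)
  have hi := memLp_one_iff_integrable.1
    (hl.memLp_comp le_rfl hw (memLp_one_iff_integrable.2 hw') t)
  have h1 : ∫ x in Ioo (0 : ℝ) 1, |w (t + phase l x)| ≤ C * ∫ s, |w s| := by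
    have h2 := hC w t hw
    rw [eLpNorm_one_eq_lintegral_enorm, eLpNorm_one_eq_lintegral_enorm,
      ← ofReal_integral_norm_eq_lintegral_enorm hi, ← ofReal_integral_norm_eq_lintegral_enorm hw',
      ← ENNReal.ofReal_coe_nnreal, ← ENNReal.ofReal_mul (NNReal.coe_nonneg C),
      ENNReal.ofReal_le_ofReal_iff (mul_nonneg (NNReal.coe_nonneg C) (integral_nonneg fun _ => norm_nonneg _))] at h2
    exact h2
  simp only [← Real.norm_eq_abs] at h1 ⊢
  calc ‖∫ x in Ioo (0 : ℝ) 1, w (t + phase l x) * k x‖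
      ≤ ∫ x in Ioo (0 : ℝ) 1, M * ‖w (t + phase l x)‖ := by
        refine norm_integral_le_of_norm_le (hi.norm.const_mul M)
          (Filter.Eventually.of_forall fun x => ?_)
        rw [norm_mul, mul_comm]
        exact mul_le_mul_of_nonneg_right (hk x) (norm_nonneg _)
    _ = M * ∫ x in Ioo (0 : ℝ) 1, ‖w (t + phase l x)‖ := integral_const_mul _ _
    _ ≤ M * (C * ∫ s, ‖w s‖) := mul_le_mul_of_nonneg_left h1 hM
    _ = _ := by ring

theorem abs_setIntegral_comp_add_le {w k : ℝ → ℝ} {M a : ℝ} (s : Set ℝ) (hw : Integrable w)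
    (hk : ∀ x, |k x| ≤ M) : |∫ t in s, w (t + a) * k t| ≤ M * ∫ s, |w s| := by
  have hi : Integrable fun t => w (t + a) := hw.comp_add_right a
  simp only [← Real.norm_eq_abs]
  calc ‖∫ t in s, w (t + a) * k t‖ ≤ ∫ t in s, M * ‖w (t + a)‖ := by
        refine norm_integral_le_of_norm_le (hi.norm.const_mul M).integrableOn
          (Filter.Eventually.of_forall fun x => ?_)
        rw [norm_mul, mul_comm]
        exact mul_le_mul_of_nonneg_right (hk x) (norm_nonneg _)
    _ ≤ ∫ t, M * ‖w (t + a)‖ := setIntegral_le_integral (hi.norm.const_mul M)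
        (Filter.Eventually.of_forall fun x =>
          mul_nonneg ((abs_nonneg _).trans (hk 0)) (norm_nonneg _))
    _ = M * ∫ s, ‖w s‖ := by
        rw [integral_const_mul, integral_add_right_eq_self (fun s => ‖w s‖)]

theorem integrable_comp_mul (hl : IsSpeed l) {w k : ℝ → ℝ} {M : ℝ} (hw : Measurable w)
    (hw' : Integrable w) (hk : Measurable k) (hkM : ∀ x, |k x| ≤ M) (t : ℝ) :
    Integrable (fun x => w (t + phase l x) * k x) (volume.restrict (Ioo 0 1)) :=
  (memLp_one_iff_integrable.1 (hl.memLp_comp le_rfl hw (memLp_one_iff_integrable.2 hw') t)).mul_bdd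
    hk.aestronglyMeasurable (Filter.Eventually.of_forall hkM)

theorem integrable_integral_comp (hl : IsSpeed l) {w : ℝ → ℝ} {r : ℝ × ℝ → ℝ} {M : ℝ}
    (hw : Measurable w) (hw' : Integrable w) (hr : Measurable r) (hrM : ∀ z, |r z| ≤ M) (S : ℝ) :
    Integrable (fun t => ∫ x in Ioo (0 : ℝ) 1, w (t + phase l x) * r (t, x))
      (volume.restrict (Ioo 0 S)) := by
  obtain ⟨C, hC, hCw⟩ := hl.exists_integral_comp_le
  refine Measure.integrableOn_of_bounded (M := C * M * ∫ s, |w s|) (by simp) ?_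
    (Filter.Eventually.of_forall fun t =>
      hCw w (fun x => r (t, x)) M t hw hw' fun x => hrM _)
  have h1 : Measurable fun z : ℝ × ℝ => w (z.1 + phase l z.2) * r z :=
    (hw.comp (measurable_fst.add (hl.continuous_phase.measurable.comp measurable_snd))).mul hr
  exact h1.stronglyMeasurable.integral_prod_right.aestronglyMeasurable

theorem integrable_comp_add_mul {w k : ℝ → ℝ} {M : ℝ} (hw : Integrable w) (hk : Measurable k)
    (hkM : ∀ x, |k x| ≤ M) (a : ℝ) (s : Set ℝ) :
    Integrable (fun t => w (t + a) * k t) (volume.restrict s) :=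
  (hw.comp_add_right a).integrableOn.mul_bdd hk.aestronglyMeasurable (Filter.Eventually.of_forall hkM)

theorem measurable_residual (hl : IsSpeed l) {S : ℝ} {Φ A B : ℝ × ℝ → ℝ}
    (hΦ : HasPartials S Φ A B) :
    Measurable fun z : ℝ × ℝ => A z - l z.2 * B z - deriv l z.2 * Φ z := by
  have h0 : Measurable fun z : ℝ × ℝ => deriv l z.2 := (measurable_deriv l).comp measurable_snd
  exact (hΦ.contA.measurable.sub ((hl.continuous.measurable.comp measurable_snd).mul
    hΦ.contB.measurable)).sub (h0.mul hΦ.cont.measurable)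

theorem exists_residual_le (hl : IsSpeed l) {Φ A B : ℝ × ℝ → ℝ}
    (hbd : ∃ M, ∀ z, |Φ z| ≤ M ∧ |A z| ≤ M ∧ |B z| ≤ M) :
    ∃ M, 0 ≤ M ∧ ∀ z : ℝ × ℝ, |A z - l z.2 * B z - deriv l z.2 * Φ z| ≤ M := by
  obtain ⟨M, hM⟩ := hbd
  obtain ⟨K, hK⟩ := hl.lip
  obtain ⟨L, hL⟩ := hl.upper
  have hM0 : 0 ≤ M := (abs_nonneg _).trans (hM 0).1
  have hL0 : 0 ≤ L := (abs_nonneg _).trans (hL 0)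
  refine ⟨M + L * M + K * M, by positivity, fun z => ?_⟩
  refine (abs_sub _ _).trans (add_le_add ((abs_sub _ _).trans (add_le_add (hM z).2.1 ?_)) ?_)
  · rw [abs_mul]; exact mul_le_mul (hL _) (hM z).2.2 (abs_nonneg _) hL0
  · rw [abs_mul]
    exact mul_le_mul (norm_deriv_le_of_lipschitz hK) (hM z).1 (abs_nonneg _) K.2

/-- The weak form of the transport equation `∂ₜ y = l ∂ₓ y` for `y (t, x) = w (t + phase l x)`. -/
theorem transport (hl : IsSpeed l) {S : ℝ} (hS : 0 < S) {Φ A B : ℝ × ℝ → ℝ}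
    (hΦ : HasPartials S Φ A B) (hbd : ∃ M, ∀ z, |Φ z| ≤ M ∧ |A z| ≤ M ∧ |B z| ≤ M) {w : ℝ → ℝ}
    (hwm : Measurable w) (hw : Integrable w) :
    (∫ x in Ioo (0 : ℝ) 1, w (S + phase l x) * Φ (S, x))
      - (∫ x in Ioo (0 : ℝ) 1, w (0 + phase l x) * Φ (0, x))
    = (∫ t in Ioo (0 : ℝ) S, ∫ x in Ioo (0 : ℝ) 1, w (t + phase l x) *
          (A (t, x) - l x * B (t, x) - deriv l x * Φ (t, x)))
      + (∫ t in Ioo (0 : ℝ) S, w (t + phase l 1) * (l 1 * Φ (t, 1)))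
      - ∫ t in Ioo (0 : ℝ) S, w t * (l 0 * Φ (t, 0)) := by
  obtain ⟨M', hM', hr⟩ := hl.exists_residual_le hbd
  obtain ⟨M, hM⟩ := hbd
  obtain ⟨L, hL⟩ := hl.upper
  obtain ⟨C, hC, hCw⟩ := hl.exists_integral_comp_le
  have hM0 : 0 ≤ M := (abs_nonneg _).trans (hM 0).1
  have hL0 : 0 ≤ L := (abs_nonneg _).trans (hL 0)
  have hc := hΦ.cont
  let r : ℝ × ℝ → ℝ := fun z => A z - l z.2 * B z - deriv l z.2 * Φ z
  have hrm : Measurable r := hl.measurable_residual hΦ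
  have hlΦ : ∀ x t y, |l x * Φ (t, y)| ≤ L * M := fun x t y => by
    rw [abs_mul]; exact mul_le_mul (hL _) (hM _).1 (abs_nonneg _) hL0
  -- The defect of the identity. It is linear in the profile, bounded for the `L¹` norm and zero on
  -- smooth profiles, hence zero. The term `t + 0` gives both boundary integrals the same shape.
  let D : (ℝ → ℝ) → ℝ := fun w => (∫ x in Ioo (0 : ℝ) 1, w (S + phase l x) * Φ (S, x))
      - (∫ x in Ioo (0 : ℝ) 1, w (0 + phase l x) * Φ (0, x))
    - ((∫ t in Ioo (0 : ℝ) S, ∫ x in Ioo (0 : ℝ) 1, w (t + phase l x) * r (t, x))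
      + (∫ t in Ioo (0 : ℝ) S, w (t + phase l 1) * (l 1 * Φ (t, 1)))
      - ∫ t in Ioo (0 : ℝ) S, w (t + 0) * (l 0 * Φ (t, 0)))
  suffices h : D w = 0 by
    have h' := sub_eq_zero.1 h
    simp only [add_zero] at h'
    exact h'
  -- boundedness on `L¹`
  have hbound : ∀ v : ℝ → ℝ, Measurable v → Integrable v →
      |D v| ≤ (C * M + C * M + (S * (C * M') + L * M + L * M)) * ∫ s, |v s| := by
    intro v hvm hv
    have h1 := hCw v (fun x => Φ (S, x)) M S hvm hv fun x => (hM _).1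
    have h2 := hCw v (fun x => Φ (0, x)) M 0 hvm hv fun x => (hM _).1
    have h3 : |∫ t in Ioo (0 : ℝ) S, ∫ x in Ioo (0 : ℝ) 1, v (t + phase l x) * r (t, x)| ≤
        C * M' * (∫ s, |v s|) * S := by
      have := norm_setIntegral_le_of_norm_le_const (μ := volume) (s := Ioo (0 : ℝ) S)
        (f := fun t => ∫ x in Ioo (0 : ℝ) 1, v (t + phase l x) * r (t, x))
        (C := C * M' * ∫ s, |v s|) (by simp)
        (fun t _ => hCw v (fun x => r (t, x)) M' t hvm hv fun x => hr _)
      simpa [Measure.real, hS.le] using this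
    have h4 := abs_setIntegral_comp_add_le (a := phase l 1) (Ioo 0 S) hv (fun t => hlΦ 1 t 1)
    have h5 := abs_setIntegral_comp_add_le (a := 0) (Ioo 0 S) hv (fun t => hlΦ 0 t 0)
    refine (abs_sub _ _).trans ?_
    refine (add_le_add (abs_sub _ _) ((abs_sub _ _).trans
      (add_le_add_left (abs_add_le _ _) _))).trans ?_
    linarith
  -- additivity
  have hsub : ∀ v₁ v₂ : ℝ → ℝ, Measurable v₁ → Integrable v₁ → Measurable v₂ → Integrable v₂ →
      D (fun s => v₁ s - v₂ s) = D v₁ - D v₂ := by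
    intro v₁ v₂ hm₁ hi₁ hm₂ hi₂
    have hrt : ∀ t, Measurable fun x => r (t, x) := fun t => hrm.comp measurable_prodMk_left
    have e1 : ∀ (k : ℝ → ℝ) (t N : ℝ), Measurable k → (∀ x, |k x| ≤ N) →
        ∫ x in Ioo (0 : ℝ) 1, (v₁ (t + phase l x) - v₂ (t + phase l x)) * k x =
        (∫ x in Ioo (0 : ℝ) 1, v₁ (t + phase l x) * k x) -
          ∫ x in Ioo (0 : ℝ) 1, v₂ (t + phase l x) * k x := by
      intro k t N hkm hk
      simp only [sub_mul]
      exact integral_sub (hl.integrable_comp_mul hm₁ hi₁ hkm hk t)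
        (hl.integrable_comp_mul hm₂ hi₂ hkm hk t)
    have e2 : ∀ (k : ℝ → ℝ) (a N : ℝ), Measurable k → (∀ x, |k x| ≤ N) →
        ∫ t in Ioo (0 : ℝ) S, (v₁ (t + a) - v₂ (t + a)) * k t =
        (∫ t in Ioo (0 : ℝ) S, v₁ (t + a) * k t) - ∫ t in Ioo (0 : ℝ) S, v₂ (t + a) * k t := by
      intro k t N hkm hk
      simp only [sub_mul]
      exact integral_sub (integrable_comp_add_mul hi₁ hkm hk t _)
        (integrable_comp_add_mul hi₂ hkm hk t _)
    simp only [D]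
    rw [e1 (fun x => Φ (S, x)) S M (by fun_prop) (fun x => (hM _).1),
      e1 (fun x => Φ (0, x)) 0 M (by fun_prop) (fun x => (hM _).1),
      e2 (fun t => l 1 * Φ (t, 1)) (phase l 1) _ (by fun_prop) (fun t => hlΦ 1 t 1),
      e2 (fun t => l 0 * Φ (t, 0)) 0 _ (by fun_prop) (fun t => hlΦ 0 t 0)]
    simp only [fun t => e1 (fun x => r (t, x)) t M' (hrt t) (fun x => hr _)]
    rw [integral_sub (hl.integrable_integral_comp hm₁ hi₁ hrm hr S)
      (hl.integrable_integral_comp hm₂ hi₂ hrm hr S)]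
    ring
  -- density of smooth functions
  set N := C * M + C * M + (S * (C * M') + L * M + L * M)
  have hN : 0 ≤ N := by positivity
  refine abs_eq_zero.1 (le_antisymm (le_of_forall_pos_le_add fun ε hε => ?_) (abs_nonneg _))
  -- The accuracy `ε / (N + 1)` makes `N` times the error at most `ε`, also when `N = 0`.
  obtain ⟨v, hv1, hv2, hv3⟩ := MemLp.exist_eLpNorm_sub_le ENNReal.one_ne_top le_rfl
    (memLp_one_iff_integrable.2 hw) (div_pos hε (add_pos_of_nonneg_of_pos hN zero_lt_one))
  have hvi : Integrable v := hv2.continuous.integrable_of_hasCompactSupport hv1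
  have hD0 : D v = 0 := by
    simp only [D, add_zero]
    exact sub_eq_zero.2 (hl.transport_smooth hS hΦ (hv2.of_le (by exact_mod_cast le_top)))
  have h1 := hsub w v hwm hw hv2.continuous.measurable hvi
  rw [hD0, sub_zero] at h1
  have h2 := hbound (fun s => w s - v s) (hwm.sub hv2.continuous.measurable) (hw.sub hvi)
  have h3 : ∫ s, |w s - v s| ≤ ε / (N + 1) := by
    rw [eLpNorm_one_eq_lintegral_enorm, ← ofReal_integral_norm_eq_lintegral_enorm (hw.sub hvi),
      ENNReal.ofReal_le_ofReal_iff (by positivity)] at hv3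
    exact hv3
  rw [← h1, zero_add]
  refine h2.trans ((mul_le_mul_of_nonneg_left h3 hN).trans ?_)
  rw [mul_div_assoc', div_le_iff₀ (by positivity)]
  nlinarith

end IsSpeed

/-! ### Component speeds, their phases and the travel times -/

/-- Extension of a function on `[0,1]` to the line by its end values. -/
noncomputable def extendSpeed (f : ℝ → ℝ) (x : ℝ) : ℝ := f (projIcc 0 1 zero_le_one x)

theorem extendSpeed_eq (f : ℝ → ℝ) {x : ℝ} (hx : x ∈ Icc (0 : ℝ) 1) : extendSpeed f x = f x := by
  rw [extendSpeed, projIcc_of_mem _ hx]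

theorem deriv_extendSpeed (f : ℝ → ℝ) {x : ℝ} (hx : x ∈ Ioo (0 : ℝ) 1) :
    deriv (extendSpeed f) x = deriv f x := by
  refine Filter.EventuallyEq.deriv_eq ?_
  filter_upwards [Icc_mem_nhds hx.1 hx.2] with y hy using extendSpeed_eq f hy

theorem isSpeed_extendSpeed {f : ℝ → ℝ} {K : NNReal} (hf : LipschitzOnWith K f (Icc 0 1))
    (h0 : ∀ x ∈ Icc (0 : ℝ) 1, f x ≠ 0) : IsSpeed (extendSpeed f) := by
  have hp : ∀ x, (projIcc (0 : ℝ) 1 zero_le_one x : ℝ) ∈ Icc (0 : ℝ) 1 := fun x =>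
    (projIcc (0 : ℝ) 1 zero_le_one x).2
  refine ⟨⟨K, ?_⟩, ?_, ?_⟩
  · have h1 := hf.to_restrict.comp (LipschitzWith.projIcc (zero_le_one' ℝ))
    rw [mul_one] at h1
    exact h1
  · obtain ⟨x0, hx0, hmin⟩ := isCompact_Icc.exists_isMinOn (nonempty_Icc.2 (zero_le_one' ℝ))
      hf.continuousOn.abs
    exact ⟨|f x0|, abs_pos.2 (h0 x0 hx0), fun x => hmin (hp x)⟩
  · obtain ⟨C, hC⟩ := isCompact_Icc.exists_bound_of_continuousOn hf.continuousOn
    exact ⟨C, fun x => hC _ (hp x)⟩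

variable {p m : ℕ} {lam : Fin p ⊕ Fin m → ℝ → ℝ}

theorem IsOrderedSpeeds.ne_zero (hOrd : IsOrderedSpeeds lam) (k : Fin p ⊕ Fin m) :
    ∀ x ∈ Icc (0 : ℝ) 1, lam k x ≠ 0 := by
  intro x hx
  rcases k with i | j
  · exact ((hOrd x hx).2.1 i).ne
  · exact ((hOrd x hx).2.2.1 j).ne'

theorem isSpeed_of_isOrderedSpeeds (hLip : IsLipschitzDiag lam) (hOrd : IsOrderedSpeeds lam)
    (k : Fin p ⊕ Fin m) : IsSpeed (extendSpeed (lam k)) :=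
  isSpeed_extendSpeed (hLip k).choose_spec (hOrd.ne_zero k)

/-- The phase of the `k`-th component. -/
noncomputable def componentPhase (lam : Fin p ⊕ Fin m → ℝ → ℝ) (k : Fin p ⊕ Fin m) : ℝ → ℝ :=
  phase (extendSpeed (lam k))

theorem phase_extendSpeed_one (f : ℝ → ℝ) :
    phase (extendSpeed f) 1 = ∫ x in (0 : ℝ)..1, (f x)⁻¹ :=
  intervalIntegral.integral_congr fun x hx => by
    rw [uIcc_of_le zero_le_one] at hx
    simp only [extendSpeed_eq f hx]

/-- The set of exit times is a singleton. The sign appears because the phase of a negative speed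
decreases. -/
theorem travelTime_inl (hLip : IsLipschitzDiag lam) (hOrd : IsOrderedSpeeds lam) (i : Fin p) :
    travelTime lam (Sum.inl i) = -componentPhase lam (Sum.inl i) 1 := by
  rw [travelTime, exitTime, exitTimes_neg (hLip _).choose_spec.continuousOn
    (fun x hx => (hOrd x hx).2.1 i), csInf_singleton, componentPhase, phase_extendSpeed_one,
    intervalIntegral.integral_neg]

theorem travelTime_inr (hLip : IsLipschitzDiag lam) (hOrd : IsOrderedSpeeds lam) (j : Fin m) :
    travelTime lam (Sum.inr j) = componentPhase lam (Sum.inr j) 1 := by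
  rw [travelTime, exitTime, exitTimes_pos (hLip _).choose_spec.continuousOn
    (fun x hx => (hOrd x hx).2.2.1 j), csInf_singleton, componentPhase, phase_extendSpeed_one]

theorem componentPhase_zero (k : Fin p ⊕ Fin m) : componentPhase lam k 0 = 0 :=
  intervalIntegral.integral_same

theorem strictMono_componentPhase (hLip : IsLipschitzDiag lam) (hOrd : IsOrderedSpeeds lam)
    (j : Fin m) : StrictMono (componentPhase lam (Sum.inr j)) :=
  strictMono_of_deriv_pos fun x => by
    rw [componentPhase, ((isSpeed_of_isOrderedSpeeds hLip hOrd _).hasDerivAt_phase x).deriv]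
    exact inv_pos.2 ((hOrd _ (projIcc (0 : ℝ) 1 zero_le_one x).2).2.2.1 j)

theorem strictAnti_componentPhase (hLip : IsLipschitzDiag lam) (hOrd : IsOrderedSpeeds lam)
    (i : Fin p) : StrictAnti (componentPhase lam (Sum.inl i)) :=
  strictAnti_of_deriv_neg fun x => by
    rw [componentPhase, ((isSpeed_of_isOrderedSpeeds hLip hOrd _).hasDerivAt_phase x).deriv]
    exact inv_lt_zero.2 ((hOrd _ (projIcc (0 : ℝ) 1 zero_le_one x).2).2.1 i)

theorem componentPhase_inr_mem (hLip : IsLipschitzDiag lam) (hOrd : IsOrderedSpeeds lam)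
    (j : Fin m) {x : ℝ} (hx : x ∈ Ioo (0 : ℝ) 1) :
    componentPhase lam (Sum.inr j) x ∈ Ioo 0 (travelTime lam (Sum.inr j)) := by
  have h := strictMono_componentPhase hLip hOrd j
  rw [travelTime_inr hLip hOrd]
  refine ⟨?_, h hx.2⟩
  have := h hx.1
  rwa [componentPhase_zero] at this

theorem componentPhase_inl_mem (hLip : IsLipschitzDiag lam) (hOrd : IsOrderedSpeeds lam)
    (i : Fin p) {x : ℝ} (hx : x ∈ Ioo (0 : ℝ) 1) :
    componentPhase lam (Sum.inl i) x ∈ Ioo (-travelTime lam (Sum.inl i)) 0 := by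
  have h := strictAnti_componentPhase hLip hOrd i
  rw [travelTime_inl hLip hOrd, neg_neg]
  refine ⟨h hx.2, ?_⟩
  have := h hx.1
  rwa [componentPhase_zero] at this

theorem travelTime_pos (hLip : IsLipschitzDiag lam) (hOrd : IsOrderedSpeeds lam)
    (k : Fin p ⊕ Fin m) : 0 < travelTime lam k := by
  have hx : (1 / 2 : ℝ) ∈ Ioo (0 : ℝ) 1 := by norm_num
  rcases k with i | j
  · have := componentPhase_inl_mem hLip hOrd i hx
    linarith [this.1, this.2]
  · have := componentPhase_inr_mem hLip hOrd j hx
    linarith [this.1, this.2]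

theorem phase_one_le {f g : ℝ → ℝ} (hf : IsSpeed (extendSpeed f)) (hg : IsSpeed (extendSpeed g))
    (h : ∀ x ∈ Icc (0 : ℝ) 1, (f x)⁻¹ ≤ (g x)⁻¹) :
    phase (extendSpeed f) 1 ≤ phase (extendSpeed g) 1 :=
  intervalIntegral.integral_mono_on zero_le_one (hf.continuous_inv.intervalIntegrable _ _)
    (hg.continuous_inv.intervalIntegrable _ _) fun x hx => by
      simpa only [extendSpeed_eq _ hx] using h x hx

theorem travelTime_inl_mono (hLip : IsLipschitzDiag lam) (hOrd : IsOrderedSpeeds lam)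
    {i i' : Fin p} (h : i ≤ i') : travelTime lam (Sum.inl i) ≤ travelTime lam (Sum.inl i') := by
  rw [travelTime_inl hLip hOrd, travelTime_inl hLip hOrd, neg_le_neg_iff]
  refine phase_one_le (isSpeed_of_isOrderedSpeeds hLip hOrd _)
    (isSpeed_of_isOrderedSpeeds hLip hOrd _) fun x hx => ?_
  exact (inv_le_inv_of_neg ((hOrd x hx).2.1 i') ((hOrd x hx).2.1 i)).2 ((hOrd x hx).1 i i' h)

theorem travelTime_inr_anti (hLip : IsLipschitzDiag lam) (hOrd : IsOrderedSpeeds lam)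
    {j j' : Fin m} (h : j ≤ j') : travelTime lam (Sum.inr j') ≤ travelTime lam (Sum.inr j) := by
  rw [travelTime_inr hLip hOrd, travelTime_inr hLip hOrd]
  refine phase_one_le (isSpeed_of_isOrderedSpeeds hLip hOrd _)
    (isSpeed_of_isOrderedSpeeds hLip hOrd _) fun x hx => ?_
  exact inv_anti₀ ((hOrd x hx).2.2.1 j) ((hOrd x hx).2.2.2 j j' h)

/-! ### Weak solutions from travelling profiles -/

/-- The boundary condition of test functions at `x = 0` in weighted form. -/
theorem IsTestFunction.weighted_left_eq {Q : Matrix (Fin p) (Fin m) ℝ} {S : ℝ}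
    {φ : Fin p ⊕ Fin m → ℝ × ℝ → ℝ} (hOrd : IsOrderedSpeeds lam) (hφ : IsTestFunction lam Q S φ)
    {t : ℝ} (ht : t ∈ Icc 0 S) (j : Fin m) :
    lam (Sum.inr j) 0 * φ (Sum.inr j) (t, 0) =
      -∑ i, Q i j * (lam (Sum.inl i) 0 * φ (Sum.inl i) (t, 0)) := by
  have h0 := hOrd.ne_zero (Sum.inr j) 0 (by simp)
  rw [hφ.left_eq t ht j, Matrix.mulVec, dotProduct, Finset.mul_sum, ← Finset.sum_neg_distrib]
  refine Finset.sum_congr rfl fun i _ => ?_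
  simp only [adjointBoundaryMatrix, Matrix.transpose_apply, Matrix.neg_apply,
    Matrix.mul_diagonal, Matrix.diagonal_mul]
  field_simp

/-- Superpositions of travelling profiles that satisfy the boundary conditions are weak
solutions. -/
theorem isWeakSolution_of_profiles (hLip : IsLipschitzDiag lam) (hOrd : IsOrderedSpeeds lam)
    {Q : Matrix (Fin p) (Fin m) ℝ} {w : Fin p ⊕ Fin m → ℝ → ℝ} (hwm : ∀ k, Measurable (w k))
    (hw1 : ∀ k, Integrable (w k)) (hw2 : ∀ k, MemLp (w k) 2 volume)
    (hQ : ∀ t, 0 < t → ∀ i, w (Sum.inl i) t = ∑ j, Q i j * w (Sum.inr j) t)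
    {y0 : StateSpace p m} (hy0 : ∀ k, ∀ᵐ x ∂(volume.restrict (Ioo (0 : ℝ) 1)),
      y0 k x = w k (componentPhase lam k x))
    {u : ControlSpace m} (hu : ∀ j, ∀ᵐ t ∂(volume.restrict (Ioi (0 : ℝ))),
      u j t = w (Sum.inr j) (t + componentPhase lam (Sum.inr j) 1)) :
    ∃ y : ℝ → StateSpace p m, IsWeakSolution lam Q y0 u y ∧
      ∀ t k, ∀ᵐ x ∂(volume.restrict (Ioo (0 : ℝ) 1)),
        y t k x = w k (t + componentPhase lam k x) := by
  have hs := isSpeed_of_isOrderedSpeeds hLip hOrd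
  let y : ℝ → StateSpace p m := fun t => WithLp.toLp 2 fun k =>
    ((hs k).memLp_comp one_le_two (hwm k) (hw2 k) t).toLp
  have hyw : ∀ t k, ∀ᵐ x ∂(volume.restrict (Ioo (0 : ℝ) 1)),
      y t k x = w k (t + componentPhase lam k x) := fun t k =>
    ((hs k).memLp_comp one_le_two (hwm k) (hw2 k) t).coeFn_toLp
  refine ⟨y, ⟨Continuous.continuousOn ?_, ?_⟩, hyw⟩
  · exact (PiLp.continuous_toLp 2 _).comp
      (continuous_pi fun k => (hs k).continuous_toLp_comp (hwm k) (hw2 k))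
  intro S hS φ hφ
  have hsub : Ioo 0 S ⊆ Icc 0 S := Ioo_subset_Icc_self
  choose Φ A B hΦ hΦφ hbd hder using fun k => exists_hasPartials hS (hφ.contDiffOn k)
  choose M hM using hbd
  choose N hN hNr using fun k => (hs k).exists_residual_le ⟨M k, hM k⟩
  have htr := fun k => (hs k).transport hS (hΦ k) ⟨M k, hM k⟩ (hwm k) (hw1 k)
  have hΦm : ∀ k, Measurable (Φ k) := fun k => (hΦ k).cont.measurable
  -- integrals over `(0,1)` at fixed time
  have hfix : ∀ (Y : StateSpace p m) (t s : ℝ), (∀ k, ∀ᵐ x ∂(volume.restrict (Ioo (0 : ℝ) 1)),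
      Y k x = w k (t + componentPhase lam k x)) → s ∈ Icc 0 S →
      ∫ x in Ioo (0 : ℝ) 1, ∑ k, Y k x * φ k (s, x) =
        ∑ k, ∫ x in Ioo (0 : ℝ) 1, w k (t + phase (extendSpeed (lam k)) x) * Φ k (s, x) := by
    intro Y t s hY hs'
    rw [← integral_finsetSum _ fun k _ => (hs k).integrable_comp_mul (hwm k) (hw1 k)
      (k := fun x => Φ k (s, x)) ((hΦm k).comp measurable_prodMk_left) (fun x => (hM k _).1) t]
    refine integral_congr_ae ?_
    filter_upwards [Filter.eventually_all.2 hY, ae_restrict_mem measurableSet_Ioo] with x hx hx'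
    refine Finset.sum_congr rfl fun k _ => ?_
    rw [hx k, hΦφ k (s, x) ⟨hs', Ioo_subset_Icc_self hx'⟩]
    rfl
  have hmid : ∀ t ∈ Ioo 0 S, ∫ x in Ioo (0 : ℝ) 1, ∑ k, y t k x *
      (deriv (fun s => φ k (s, x)) t - lam k x * deriv (fun ξ => φ k (t, ξ)) x
            - deriv (lam k) x * φ k (t, x)) =
      ∑ k, ∫ x in Ioo (0 : ℝ) 1, w k (t + phase (extendSpeed (lam k)) x) *
        (A k (t, x) - extendSpeed (lam k) x * B k (t, x)
          - deriv (extendSpeed (lam k)) x * Φ k (t, x)) := by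
    intro t ht
    rw [← integral_finsetSum _ fun k _ => (hs k).integrable_comp_mul (hwm k) (hw1 k)
      (k := fun x => A k (t, x) - extendSpeed (lam k) x * B k (t, x)
          - deriv (extendSpeed (lam k)) x * Φ k (t, x))
      (((hs k).measurable_residual (hΦ k)).comp measurable_prodMk_left) (fun x => hNr k (t, x)) t]
    refine integral_congr_ae ?_
    filter_upwards [Filter.eventually_all.2 (hyw t), ae_restrict_mem measurableSet_Ioo] with x hx hx'
    refine Finset.sum_congr rfl fun k _ => ?_
    rw [hx k, hΦφ k (t, x) ⟨hsub ht, Ioo_subset_Icc_self hx'⟩, (hder k t ht x hx').1,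
      (hder k t ht x hx').2, extendSpeed_eq _ (Ioo_subset_Icc_self hx'), deriv_extendSpeed _ hx']
    rfl
  have hbi : ∀ (k : Fin p ⊕ Fin m) (a x : ℝ), Integrable
      (fun t => w k (t + a) * (extendSpeed (lam k) x * Φ k (t, x)))
      (volume.restrict (Ioo 0 S)) := fun k a x =>
    IsSpeed.integrable_comp_add_mul (hw1 k) (k := fun t => extendSpeed (lam k) x * Φ k (t, x))
      (M := |extendSpeed (lam k) x| * M k)
      (((hΦm k).comp measurable_prodMk_right).const_mul _) (fun t => by
        rw [abs_mul]; exact mul_le_mul_of_nonneg_left (hM k _).1 (abs_nonneg _)) a _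
  -- The boundary terms at `x = 0` cancel by duality: `w₊ = Q w₋` for the profiles, and the
  -- transposed relation with a minus sign for the weighted traces of the test function.
  have hleft : ∑ k, ∫ t in Ioo (0 : ℝ) S, w k t * (extendSpeed (lam k) 0 * Φ k (t, 0)) = 0 := by
    rw [← integral_finsetSum _ fun k _ => by simpa using hbi k 0 0]
    refine (setIntegral_congr_fun measurableSet_Ioo fun t ht => ?_).trans (integral_zero _ _)
    have hz : ((t, 0) : ℝ × ℝ) ∈ Icc 0 S ×ˢ Icc (0 : ℝ) 1 := ⟨hsub ht, by simp⟩
    simp only [fun k => hΦφ k (t, 0) hz, fun k => extendSpeed_eq (lam k) (x := 0) (by simp)]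
    rw [Fintype.sum_sum_type]
    simp only [hφ.weighted_left_eq hOrd (hsub ht), hQ t ht.1, Finset.sum_mul, mul_neg,
      Finset.mul_sum, Finset.sum_neg_distrib]
    rw [Finset.sum_comm, ← sub_eq_add_neg, sub_eq_zero]
    exact Finset.sum_congr rfl fun j _ => Finset.sum_congr rfl fun i _ => by ring
  -- At `x = 1` the components `φ₊` vanish, and the traces of the others are the control.
  have hright : ∑ k, ∫ t in Ioo (0 : ℝ) S, w k (t + phase (extendSpeed (lam k)) 1) *
      (extendSpeed (lam k) 1 * Φ k (t, 1)) =
      ∫ t in Ioo (0 : ℝ) S, ∑ j : Fin m,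
          u j t * (lam (Sum.inr j) 1 * φ (Sum.inr j) (t, 1)) := by
    rw [← integral_finsetSum _ fun k _ => hbi k _ 1]
    refine integral_congr_ae ?_
    filter_upwards [Filter.eventually_all.2 fun j =>
        ae_restrict_of_ae_restrict_of_subset Ioo_subset_Ioi_self (hu j),
      ae_restrict_mem measurableSet_Ioo] with t htu ht
    have hz : ((t, 1) : ℝ × ℝ) ∈ Icc 0 S ×ˢ Icc (0 : ℝ) 1 := ⟨hsub ht, by simp⟩
    simp only [fun k => hΦφ k (t, 1) hz, fun k => extendSpeed_eq (lam k) (x := 1) (by simp), htu]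
    rw [Fintype.sum_sum_type]
    simp only [hφ.right_eq t (hsub ht), mul_zero, Finset.sum_const_zero, zero_add]
    rfl
  rw [hfix (y S) S S (hyw S) ⟨hS.le, le_rfl⟩,
    hfix y0 0 0 (fun k => by simpa using hy0 k) ⟨le_rfl, hS.le⟩,
    setIntegral_congr_fun measurableSet_Ioo hmid,
    integral_finsetSum _ fun k _ => (hs k).integrable_integral_comp (hwm k) (hw1 k)
      ((hs k).measurable_residual (hΦ k)) (hNr k) S, ← hright]
  have hsum := Finset.sum_congr (rfl : (Finset.univ : Finset (Fin p ⊕ Fin m)) = Finset.univ)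
    fun k _ => htr k
  rw [Finset.sum_sub_distrib, Finset.sum_sub_distrib, Finset.sum_add_distrib, hleft,
    sub_zero] at hsum
  exact hsum

/-! ### Linear algebra of the canonical form -/

/-- An earlier pivot column lies left of the pivot of row `i`, or right of it without being a later
pivot. Hence the pivot columns, in the order of `c`, form an upper triangular matrix. -/
theorem IsCanonicalIndices.eq_zero_of_lt {Q0 : Matrix (Fin p) (Fin m) ℝ} {c : Fin p → Fin m}
    (hc : IsCanonicalIndices Q0 c) {i k : Fin p} (h : k < i) : Q0 i (c k) = 0 := by
  rcases lt_trichotomy (c k) (c i) with h1 | h1 | h1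
  · exact (hc.2 i).2.2 _ h1
  · exact absurd (hc.1 h1) h.ne
  · exact (hc.2 i).2.1 _ h1 fun k' hk' e => (h.trans hk').ne (hc.1 e)

/-- If the pivot of every row in the final segment `I` is in the final segment `J`, then the rows
in `I` of `Q W` and the entries of `W` outside `J` can be prescribed. -/
theorem exists_prescribed {Q : Matrix (Fin p) (Fin m) ℝ} {L : Matrix (Fin m) (Fin m) ℝ}
    {c : Fin p → Fin m} (hL : IsUnitLower L) (hc : IsCanonicalIndices (Q * L) c)
    {I : Fin p → Prop} {J : Fin m → Prop} (hI : ∀ i i', i ≤ i' → I i → I i')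
    (hJ : ∀ j j', j ≤ j' → J j → J j') (hIJ : ∀ i, I i → J (c i)) (d : Fin p ⊕ Fin m → ℝ) :
    ∃ W : Fin m → ℝ, (∀ j, ¬J j → W j = d (Sum.inr j)) ∧
      ∀ i, I i → ∑ j, Q i j * W j = d (Sum.inl i) := by
  classical
  let N : Matrix (Fin p) (Fin p) ℝ := (Q * L).submatrix id c
  have hN : IsUnit N.det := by
    rw [Matrix.det_of_isUpperTriangular (M := N) (fun i k h => hc.eq_zero_of_lt h), isUnit_iff_ne_zero,
      Finset.prod_ne_zero_iff]
    exact fun i _ => (hc.2 i).1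
  -- `b` carries the given entries and `L z` corrects the prescribed rows. The vector `z` lives on
  -- pivot columns inside `J`; since `L` is lower triangular and `J` is a final segment, `L z` does
  -- not touch the given entries.
  let b : Fin m → ℝ := fun j => if J j then 0 else d (Sum.inr j)
  let r : Fin p → ℝ := fun i => d (Sum.inl i) - Q.mulVec b i
  let ζ : Fin p → ℝ := N⁻¹.mulVec r
  have hζ : N.mulVec ζ = r := by
    rw [Matrix.mulVec_mulVec, Matrix.mul_nonsing_inv _ hN, Matrix.one_mulVec]
  let z : Fin m → ℝ := ∑ k, if I k then Pi.single (c k) (ζ k) else 0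
  have hz : ∀ j, ¬J j → z j = 0 := by
    intro j hj
    simp only [z, Finset.sum_apply]
    refine Finset.sum_eq_zero fun k _ => ?_
    split_ifs with hk
    · exact Pi.single_eq_of_ne (fun e => hj (by rw [e]; exact hIJ k hk)) _
    · rfl
  refine ⟨b + L.mulVec z, fun j hj => ?_, fun i hi => ?_⟩
  · have h0 : L.mulVec z j = 0 := by
      rw [Matrix.mulVec, dotProduct]
      refine Finset.sum_eq_zero fun k _ => ?_
      rcases lt_or_ge j k with h | h
      · rw [hL.1 _ _ h, zero_mul]
      · rw [hz k fun hk => hj (hJ _ _ h hk), mul_zero]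
    rw [Pi.add_apply, h0, add_zero]
    simp only [b, if_neg hj]
  · have h1 : (Q * L).mulVec z i = N.mulVec ζ i := by
      simp only [z, Matrix.mulVec_sum, Finset.sum_apply]
      rw [Matrix.mulVec, dotProduct]
      refine Finset.sum_congr rfl fun k _ => ?_
      split_ifs with hk
      · rw [Matrix.mulVec_single]
        simp [N]
      -- Dropping the unknowns outside `I` is harmless: `N` is upper triangular and `I` is a final
      -- segment, so rows in `I` do not involve them.
      · have hki : k < i := lt_of_not_ge fun h => hk (hI _ _ h hi)
        simp [N, hc.eq_zero_of_lt hki]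
    change Q.mulVec (b + L.mulVec z) i = _
    rw [Matrix.mulVec_add, Pi.add_apply, Matrix.mulVec_mulVec, h1, hζ]
    simp only [r]
    ring

/-- Solving for the basis vectors makes the choice linear in the data. The matrix then depends only
on `I` and `J`, not on the data. -/
theorem exists_prescribing_matrix {Q : Matrix (Fin p) (Fin m) ℝ} {L : Matrix (Fin m) (Fin m) ℝ}
    {c : Fin p → Fin m} (hL : IsUnitLower L) (hc : IsCanonicalIndices (Q * L) c)
    {I : Fin p → Prop} {J : Fin m → Prop} (hI : ∀ i i', i ≤ i' → I i → I i')
    (hJ : ∀ j j', j ≤ j' → J j → J j') (hIJ : ∀ i, I i → J (c i)) :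
    ∃ M : Matrix (Fin m) (Fin p ⊕ Fin m) ℝ, ∀ d : Fin p ⊕ Fin m → ℝ,
      (∀ j, ¬J j → M.mulVec d j = d (Sum.inr j)) ∧
      ∀ i, I i → ∑ j, Q i j * M.mulVec d j = d (Sum.inl i) := by
  choose W hW1 hW2 using fun k : Fin p ⊕ Fin m =>
    exists_prescribed hL hc hI hJ hIJ (Pi.single k 1)
  refine ⟨Matrix.of fun j k => W k j, fun d => ⟨fun j hj => ?_, fun i hi => ?_⟩⟩
  · simp only [Matrix.mulVec, dotProduct, Matrix.of_apply, hW1 _ j hj]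
    simp [Pi.single_apply]
  · simp only [Matrix.mulVec, dotProduct, Matrix.of_apply, Finset.mul_sum]
    rw [Finset.sum_comm]
    simp only [← mul_assoc, ← Finset.sum_mul, hW2 _ i hi]
    simp [Pi.single_apply]

/-- A nonzero combination of the rows from `i₀` on that vanishes in the columns after the pivot of
row `i₀`. -/
theorem exists_annihilator {Q : Matrix (Fin p) (Fin m) ℝ} {L : Matrix (Fin m) (Fin m) ℝ}
    {c : Fin p → Fin m} (hL : IsUnitLower L) (hc : IsCanonicalIndices (Q * L) c) (i₀ : Fin p) :
    ∃ η : Fin p → ℝ, η ≠ 0 ∧ (∀ i, i < i₀ → η i = 0) ∧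
      ∀ j, c i₀ < j → ∑ i, η i * Q i j = 0 := by
  classical
  -- The kernel of `F` encodes the wanted conditions: zero entries before `i₀` and orthogonality to
  -- the pivot columns of the later rows. The coordinate `i₀` carries no condition, so `F` is not
  -- surjective, hence not injective.
  let F : (Fin p → ℝ) →ₗ[ℝ] (Fin p → ℝ) := LinearMap.pi fun i =>
    if i < i₀ then LinearMap.proj i else if i = i₀ then 0 else
      ∑ k, (Q * L) k (c i) • LinearMap.proj k
  have hF : ¬Function.Injective F := by
    rw [LinearMap.injective_iff_surjective]
    intro hsurj
    obtain ⟨v, hv⟩ := hsurj (Pi.single i₀ 1)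
    have := congrFun hv i₀
    simp [F] at this
  obtain ⟨η, hη, hη0⟩ : ∃ η, F η = 0 ∧ η ≠ 0 := by
    rw [← LinearMap.ker_eq_bot, Submodule.eq_bot_iff] at hF
    push Not at hF
    exact hF
  have h1 : ∀ i, i < i₀ → η i = 0 := fun i hi => by
    simpa [F, hi] using congrFun hη i
  have h2 : ∀ i, i₀ < i → ∑ k, η k * (Q * L) k (c i) = 0 := fun i hi => by
    have := congrFun hη i
    simpa [F, hi.not_gt, hi.ne', mul_comm] using this
  have h3 : ∀ j, c i₀ < j → Matrix.vecMul η (Q * L) j = 0 := by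
    intro j hj
    rw [Matrix.vecMul, dotProduct]
    by_cases hex : ∃ i, i₀ < i ∧ j = c i
    · obtain ⟨i, hi, rfl⟩ := hex
      exact h2 i hi
    · push Not at hex
      -- In a column after `c i₀` that is no later pivot, every row from `i₀` on is zero: left of
      -- its pivot, or right of it and outside the later pivots.
      refine Finset.sum_eq_zero fun k _ => ?_
      rcases lt_or_ge k i₀ with hk | hk
      · rw [h1 k hk, zero_mul]
      · have hne : j ≠ c k := by
          rcases hk.eq_or_lt with rfl | hk
          · exact hj.ne'
          · exact hex k hk
        rcases lt_or_gt_of_ne hne with h | h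
        · rw [(hc.2 k).2.2 j h, mul_zero]
        · rw [(hc.2 k).2.1 j h fun k' hk' => hex k' (hk.trans_lt hk'), mul_zero]
  refine ⟨η, hη0, h1, fun j hj => ?_⟩
  have hdet : IsUnit L.det := by rw [hL.det]; exact isUnit_one
  -- Since `L⁻¹` is lower triangular, column `j` of `Q` combines only columns `l ≥ j` of `Q * L`.
  have h4 : Matrix.vecMul η Q = Matrix.vecMul (Matrix.vecMul η (Q * L)) L⁻¹ := by
    rw [Matrix.vecMul_vecMul, Matrix.mul_assoc, Matrix.mul_nonsing_inv _ hdet, Matrix.mul_one]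
  change Matrix.vecMul η Q j = 0
  rw [h4, Matrix.vecMul, dotProduct]
  refine Finset.sum_eq_zero fun l _ => ?_
  rcases lt_or_ge l j with h | h
  · rw [hL.inv.1 _ _ h, mul_zero]
  · rw [h3 l (hj.trans_le h), zero_mul]

theorem exists_left_annihilator {Q : Matrix (Fin p) (Fin m) ℝ} (hQ : Q.rank ≠ p) :
    ∃ η : Fin p → ℝ, η ≠ 0 ∧ ∀ j, ∑ i, η i * Q i j = 0 := by
  have hdep : ¬LinearIndependent ℝ Q.row := fun h => hQ (by
    rw [h.rank_matrix, Fintype.card_fin])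
  rw [Fintype.not_linearIndependent_iff] at hdep
  obtain ⟨η, h1, i, hi⟩ := hdep
  refine ⟨η, fun e => hi (by rw [e]; rfl), fun j => ?_⟩
  simpa [Finset.sum_apply] using congrFun h1 j

/-- A time dependent linear selection of boundary values: at time `s` the components with
`s < θ j` are given, and the rows with `τ i < s` of `Q W` are prescribed. -/
theorem exists_selection {Q : Matrix (Fin p) (Fin m) ℝ} {L : Matrix (Fin m) (Fin m) ℝ}
    {c : Fin p → Fin m} (hL : IsUnitLower L) (hc : IsCanonicalIndices (Q * L) c)
    {τ : Fin p → ℝ} {θ : Fin m → ℝ} (hτ : Antitone τ) (hθ : Antitone θ)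
    (hcτ : ∀ i, θ (c i) ≤ τ i) :
    ∃ M : ℝ → Matrix (Fin m) (Fin p ⊕ Fin m) ℝ, (∀ j k, Measurable fun s => M s j k) ∧
      (∃ C, ∀ s j k, |M s j k| ≤ C) ∧ ∀ s d,
        (∀ j, s < θ j → (M s).mulVec d j = d (Sum.inr j)) ∧
        ∀ i, τ i < s → ∑ j, Q i j * (M s).mulVec d j = d (Sum.inl i) := by
  classical
  let P : (Fin p → Prop) × (Fin m → Prop) → Matrix (Fin m) (Fin p ⊕ Fin m) ℝ → Prop :=
    fun z M => ∀ d : Fin p ⊕ Fin m → ℝ, (∀ j, ¬z.2 j → M.mulVec d j = d (Sum.inr j)) ∧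
      ∀ i, z.1 i → ∑ j, Q i j * M.mulVec d j = d (Sum.inl i)
  let G : (Fin p → Prop) × (Fin m → Prop) → Matrix (Fin m) (Fin p ⊕ Fin m) ℝ :=
    fun z => if h : ∃ M, P z M then h.choose else 0
  -- Time enters only through the pattern of prescribed rows and free columns. There are finitely
  -- many patterns, which yields both measurability and the uniform bound.
  let pat : ℝ → (Fin p → Prop) × (Fin m → Prop) := fun s => (fun i => τ i < s, fun j => θ j ≤ s)
  have hpat : Measurable pat := by
    refine Measurable.prodMk (measurable_pi_iff.2 fun i => ?_) (measurable_pi_iff.2 fun j => ?_)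
    · exact measurableSet_setOfPred.1 measurableSet_Ioi
    · exact measurableSet_setOfPred.1 measurableSet_Ici
  have hG : ∀ s, P (pat s) (G (pat s)) := by
    intro s
    have hex : ∃ M, P (pat s) M :=
      -- A prescribed row has a free pivot: `θ (c i) ≤ τ i < s`.
      exists_prescribing_matrix hL hc (fun i i' h hi => (hτ h).trans_lt hi)
        (fun j j' h hj => (hθ h).trans hj) (fun i hi => (hcτ i).trans hi.le)
    simp only [G, dif_pos hex]
    exact hex.choose_spec
  refine ⟨fun s => G (pat s), fun j k => ?_, ?_, fun s d => ?_⟩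
  · exact (Measurable.of_discrete (f := fun z => G z j k)).comp hpat
  · refine ⟨∑ z, ∑ j, ∑ k, |G z j k|, fun s j k => ?_⟩
    calc |G (pat s) j k| ≤ ∑ k, |G (pat s) j k| :=
          Finset.single_le_sum (f := fun k => |G (pat s) j k|) (fun _ _ => abs_nonneg _)
            (Finset.mem_univ k)
      _ ≤ ∑ j, ∑ k, |G (pat s) j k| :=
          Finset.single_le_sum (f := fun j => ∑ k, |G (pat s) j k|)
            (fun _ _ => Finset.sum_nonneg fun _ _ => abs_nonneg _) (Finset.mem_univ j)
      _ ≤ _ := Finset.single_le_sum (f := fun z => ∑ j, ∑ k, |G z j k|)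
            (fun _ _ => Finset.sum_nonneg fun _ _ => Finset.sum_nonneg fun _ _ => abs_nonneg _)
            (Finset.mem_univ (pat s))
  · exact ⟨fun j hj => (hG s d).1 j (not_le.2 hj), fun i hi => (hG s d).2 i hi⟩

/-! ### Sufficiency: construction of the control -/

/-- The profile `s ↦ y k (x)`, `s = componentPhase lam k x`, of a component of a state. -/
noncomputable def profile (lam : Fin p ⊕ Fin m → ℝ → ℝ) (y : StateSpace p m)
    (k : Fin p ⊕ Fin m) : ℝ → ℝ :=
  Function.extend (componentPhase lam k) ((Ioo (0 : ℝ) 1).indicator (y k)) 0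

theorem profile_componentPhase (hLip : IsLipschitzDiag lam) (hOrd : IsOrderedSpeeds lam)
    (y : StateSpace p m) (k : Fin p ⊕ Fin m) {x : ℝ} (hx : x ∈ Ioo (0 : ℝ) 1) :
    profile lam y k (componentPhase lam k x) = y k x := by
  rw [profile, componentPhase,
    (isSpeed_of_isOrderedSpeeds hLip hOrd k).injective_phase.extend_apply, indicator_of_mem hx]

theorem measurable_indicator_state (y : StateSpace p m) (k : Fin p ⊕ Fin m) :
    Measurable ((Ioo (0 : ℝ) 1).indicator (y k)) :=
  (Lp.stronglyMeasurable (y k)).measurable.indicator measurableSet_Ioo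

theorem measurable_profile (hLip : IsLipschitzDiag lam) (hOrd : IsOrderedSpeeds lam)
    (y : StateSpace p m) (k : Fin p ⊕ Fin m) : Measurable (profile lam y k) :=
  (isSpeed_of_isOrderedSpeeds hLip hOrd k).measurableEmbedding_phase.measurable_extend
    (measurable_indicator_state y k) measurable_const

theorem memLp_profile (hLip : IsLipschitzDiag lam) (hOrd : IsOrderedSpeeds lam)
    (y : StateSpace p m) (k : Fin p ⊕ Fin m) {q : ENNReal} (hq : q ≤ 2) :
    MemLp (profile lam y k) q volume :=
  (isSpeed_of_isOrderedSpeeds hLip hOrd k).memLp_extend (measurable_indicator_state y k)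
    ((memLp_indicator_iff_restrict measurableSet_Ioo).2 (MemLp.mono_exponent (q := 2) (Lp.memLp (y k)) hq))

/-- The traces at `x = 0` are chosen first and the control is read off at `x = 1`. The bound `hT2`
says that when row `i` becomes prescribed, at time `T - T_i`, the data of `y0` in its pivot column
have already left through `x = 0`; `hT1` says that the data of `y0` and `y1` in one column do not
overlap. -/
theorem isExactlyControllable_of_le (hLip : IsLipschitzDiag lam) (hOrd : IsOrderedSpeeds lam)
    {Q : Matrix (Fin p) (Fin m) ℝ} {L : Matrix (Fin m) (Fin m) ℝ} {c : Fin p → Fin m}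
    (hL : IsUnitLower L) (hc : IsCanonicalIndices (Q * L) c) {T : ℝ}
    (hT1 : ∀ j, travelTime lam (Sum.inr j) ≤ T)
    (hT2 : ∀ i, travelTime lam (Sum.inl i) + travelTime lam (Sum.inr (c i)) ≤ T) :
    IsExactlyControllable lam Q T := by
  intro y0 y1
  obtain ⟨M, hMm, ⟨C, hMC⟩, hM⟩ := exists_selection hL hc
    (τ := fun i => T - travelTime lam (Sum.inl i)) (θ := fun j => travelTime lam (Sum.inr j))
    (fun i i' h => sub_le_sub_left (travelTime_inl_mono hLip hOrd h) T)
    (fun j j' h => travelTime_inr_anti hLip hOrd h) (fun i => by linarith [hT2 i])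
  let a := profile lam y0
  let b : Fin p ⊕ Fin m → ℝ → ℝ := fun k s => profile lam y1 k (s - T)
  -- The data of the selection: for the rows, the final state, shifted to time `T`; for the columns,
  -- the initial state.
  let d : ℝ → Fin p ⊕ Fin m → ℝ := fun s => Sum.elim (fun i => b (Sum.inl i) s)
    (fun j => a (Sum.inr j) s)
  -- The traces of `y₋` at `x = 0`: selected before `T`, and dictated by the final state from `T`
  -- on.
  let v : Fin m → ℝ → ℝ := fun j s => (Ioo 0 T).indicator (fun s => (M s).mulVec (d s) j) s +
    (Ici T).indicator (b (Sum.inr j)) s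
  -- Phases of negative speeds are negative, so the initial state occupies `s ≤ 0`; for `s > 0` the
  -- boundary condition defines the profile.
  let w : Fin p ⊕ Fin m → ℝ → ℝ := Sum.elim
    (fun i s => (Iic 0).indicator (a (Sum.inl i)) s + (Ioi 0).indicator
      (fun s => ∑ j, Q i j * v j s) s) v
  have ham : ∀ k, Measurable (a k) := measurable_profile hLip hOrd y0
  have hbm : ∀ k, Measurable (b k) := fun k =>
    (measurable_profile hLip hOrd y1 k).comp (measurable_id.sub_const T)
  have hdm : ∀ k, Measurable fun s => d s k := by
    rintro (i | j)
    · exact hbm _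
    · exact ham _
  have hMdm : ∀ j, Measurable fun s => (M s).mulVec (d s) j := fun j => by
    simp only [Matrix.mulVec, dotProduct]
    exact Finset.measurable_sum _ fun k _ => (hMm j k).mul (hdm k)
  have hvm : ∀ j, Measurable (v j) := fun j =>
    ((hMdm j).indicator measurableSet_Ioo).add ((hbm _).indicator measurableSet_Ici)
  have hwm : ∀ k, Measurable (w k) := by
    rintro (i | j)
    · exact ((ham _).indicator measurableSet_Iic).add
        ((Finset.measurable_sum _ fun j _ => (hvm j).const_mul _).indicator measurableSet_Ioi)
    · exact hvm j
  have hwq : ∀ q : ENNReal, q ≤ 2 → ∀ k, MemLp (w k) q volume := by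
    intro q hq
    have ha : ∀ k, MemLp (a k) q volume := fun k => memLp_profile hLip hOrd y0 k hq
    have hb : ∀ k, MemLp (b k) q volume := fun k =>
      (memLp_profile hLip hOrd y1 k hq).comp_measurePreserving (measurePreserving_sub_right _ T)
    have hd : ∀ k, MemLp (fun s => d s k) q volume := by
      rintro (i | j)
      · exact hb _
      · exact ha _
    have hMd : ∀ j, MemLp (fun s => (M s).mulVec (d s) j) q volume := fun j => by
      simp only [Matrix.mulVec, dotProduct]
      refine memLp_finsetSum _ fun k _ => ?_
      refine MemLp.of_le_mul (hd k) ((hMm j k).mul (hdm k)).aestronglyMeasurable (c := C)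
        (Filter.Eventually.of_forall fun s => ?_)
      rw [norm_mul]
      exact mul_le_mul_of_nonneg_right (hMC s j k) (norm_nonneg _)
    have hv : ∀ j, MemLp (v j) q volume := fun j =>
      ((hMd j).indicator measurableSet_Ioo).add ((hb _).indicator measurableSet_Ici)
    rintro (i | j)
    · exact ((ha _).indicator measurableSet_Iic).add
        ((memLp_finsetSum _ fun j _ => (hv j).const_mul _).indicator measurableSet_Ioi)
    · exact hv j
  have hum := fun j : Fin m => ((hwq 2 le_rfl (Sum.inr j)).comp_measurePreserving
    (measurePreserving_add_right volume (componentPhase lam (Sum.inr j) 1))).restrict (Ioi 0)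
  let u : ControlSpace m := WithLp.toLp 2 fun j => (hum j).toLp
  have hv1 : ∀ j s, s ∈ Ioo 0 T → v j s = (M s).mulVec (d s) j := fun j s hs => by
    simp only [v]
    rw [indicator_of_mem hs, indicator_of_notMem (notMem_Ici.2 hs.2), add_zero]
  have hv2 : ∀ j s, T < s → v j s = b (Sum.inr j) s := fun j s hs => by
    simp only [v]
    rw [indicator_of_notMem (fun h => hs.not_gt h.2), indicator_of_mem (mem_Ici.2 hs.le), zero_add]
  have hw1 : ∀ i s, 0 < s → w (Sum.inl i) s = ∑ j, Q i j * v j s := fun i s hs => by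
    simp only [w, Sum.elim_inl]
    rw [indicator_of_notMem (notMem_Iic.2 hs), indicator_of_mem (mem_Ioi.2 hs), zero_add]
  have hy0 : ∀ k, ∀ᵐ x ∂(volume.restrict (Ioo (0 : ℝ) 1)),
      y0 k x = w k (componentPhase lam k x) := by
    intro k
    filter_upwards [ae_restrict_mem measurableSet_Ioo] with x hx'
    rw [← profile_componentPhase hLip hOrd y0 k hx']
    rcases k with i | j
    · have hi := componentPhase_inl_mem hLip hOrd i hx'
      simp only [w, Sum.elim_inl]
      rw [indicator_of_mem (mem_Iic.2 hi.2.le), indicator_of_notMem (notMem_Ioi.2 hi.2.le), add_zero]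
    · have hj := componentPhase_inr_mem hLip hOrd j hx'
      change _ = v j _
      rw [hv1 _ _ ⟨hj.1, hj.2.trans_le (hT1 j)⟩, (hM _ _).1 j hj.2]
      rfl
  obtain ⟨y, hy, hyw⟩ := isWeakSolution_of_profiles hLip hOrd (Q := Q) hwm
    (fun k => memLp_one_iff_integrable.1 (hwq 1 one_le_two k)) (hwq 2 le_rfl)
    (fun t ht i => hw1 i t ht) hy0
    (u := u) fun j => (hum j).coeFn_toLp
  refine ⟨u, y, hy, ?_⟩
  refine PiLp.ext fun k => Lp.ext ?_
  filter_upwards [hyw T k, ae_restrict_mem measurableSet_Ioo] with x hx hx'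
  rw [hx, ← profile_componentPhase hLip hOrd y1 k hx']
  rcases k with i | j
  · have hi := componentPhase_inl_mem hLip hOrd i hx'
    have hTi : travelTime lam (Sum.inl i) ≤ T := by
      linarith [hT2 i, travelTime_pos hLip hOrd (Sum.inr (c i))]
    have hs : T + componentPhase lam (Sum.inl i) x ∈ Ioo 0 T :=
      ⟨by linarith [hi.1], by linarith [hi.2]⟩
    rw [hw1 _ _ hs.1]
    simp only [hv1 _ _ hs]
    rw [(hM _ _).2 i (by linarith [hi.1])]
    simp [d, b]
  · have hj := componentPhase_inr_mem hLip hOrd j hx'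
    change v j _ = _
    rw [hv2 _ _ (by linarith [hj.1])]
    simp [b]

/-! ### Estimates in `L²` and smooth approximation of inverse speeds -/

theorem abs_integral_mul_le {α : Type*} [MeasurableSpace α] {μ : Measure α} (F : Lp ℝ 2 μ)
    {G : α → ℝ} (hG : MemLp G 2 μ) {ε : ℝ} (hε : 0 ≤ ε)
    (h : eLpNorm G 2 μ ≤ ENNReal.ofReal ε) : |∫ x, F x * G x ∂μ| ≤ ‖F‖ * ε := by
  have h1 : ∫ x, F x * G x ∂μ = inner ℝ hG.toLp F := by
    rw [L2.inner_def]
    refine integral_congr_ae ?_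
    filter_upwards [hG.coeFn_toLp] with x hx
    rw [hx]
    simp
  rw [h1, mul_comm]
  refine (abs_real_inner_le_norm _ _).trans (mul_le_mul_of_nonneg_right ?_ (norm_nonneg _))
  rw [Lp.norm_toLp]
  exact ENNReal.toReal_le_of_le_ofReal hε h

theorem integrable_Lp_mul {α : Type*} [MeasurableSpace α] {μ : Measure α} (F : Lp ℝ 2 μ)
    {G : α → ℝ} (hG : MemLp G 2 μ) : Integrable (fun x => F x * G x) μ :=
  (Lp.memLp F).integrable_mul hG

theorem memLp_of_bound {G : ℝ → ℝ} (hG : Measurable G) {C : ℝ}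
    (h : ∀ x ∈ Ioo (0 : ℝ) 1, |G x| ≤ C) : MemLp G 2 (volume.restrict (Ioo 0 1)) :=
  MemLp.of_bound hG.aestronglyMeasurable C ((ae_restrict_iff' measurableSet_Ioo).2
    (Filter.Eventually.of_forall h))

theorem eLpNorm_le_of_bound {G : ℝ → ℝ} {C : ℝ}
    (h : ∀ x ∈ Ioo (0 : ℝ) 1, |G x| ≤ C) :
    eLpNorm G 2 (volume.restrict (Ioo 0 1)) ≤ ENNReal.ofReal C := by
  refine (eLpNorm_le_of_ae_bound ((ae_restrict_iff' measurableSet_Ioo).2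
    (Filter.Eventually.of_forall h))).trans ?_
  simp

theorem continuous_bounded_on_Ioo {G : ℝ → ℝ} (hG : Continuous G) :
    ∃ C, ∀ x ∈ Ioo (0 : ℝ) 1, |G x| ≤ C := by
  obtain ⟨C, hC⟩ := (isCompact_Icc (a := (0 : ℝ)) (b := 1)).exists_bound_of_continuousOn
    hG.continuousOn
  exact ⟨C, fun x hx => hC x (Ioo_subset_Icc_self hx)⟩

namespace IsSpeed

variable {l : ℝ → ℝ}

theorem exists_lipschitz_inv (hl : IsSpeed l) : ∃ K, LipschitzWith K fun x => (l x)⁻¹ := by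
  obtain ⟨K, hK⟩ := hl.lip
  obtain ⟨c, hc, hc'⟩ := hl.lower
  refine ⟨K * (c⁻¹ * c⁻¹).toNNReal, LipschitzWith.of_dist_le_mul fun x y => ?_⟩
  have h1 : dist ((l x)⁻¹) ((l y)⁻¹) = dist (l x) (l y) * (|l x|⁻¹ * |l y|⁻¹) := by
    rw [Real.dist_eq, Real.dist_eq, inv_sub_inv (hl.ne_zero x) (hl.ne_zero y), abs_div, abs_mul,
      abs_sub_comm, div_eq_mul_inv, mul_inv]
  rw [h1, NNReal.coe_mul, Real.coe_toNNReal _ (by positivity), mul_right_comm]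
  have h2 := inv_anti₀ hc (hc' x)
  have h3 := inv_anti₀ hc (hc' y)
  exact mul_le_mul (hK.dist_le_mul x y) (mul_le_mul h2 h3 (by positivity) (by positivity))
    (by positivity) (by positivity)

/-- A continuously differentiable approximation `g` of `1 / l` with `(l g)'` small in `L²`. -/
theorem exists_inv_approx (hl : IsSpeed l) {ε : ℝ} (hε : 0 < ε) :
    ∃ g h : ℝ → ℝ, g 0 = (l 0)⁻¹ ∧ Continuous h ∧ (∀ x, HasDerivAt g (h x) x) ∧
      (∀ x ∈ Icc (0 : ℝ) 1, |g x - (l x)⁻¹| ≤ ε) ∧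
      eLpNorm (fun x => l x * h x + deriv l x * g x) 2 (volume.restrict (Ioo 0 1)) ≤
        ENNReal.ofReal ε := by
  obtain ⟨K, hK⟩ := hl.lip
  obtain ⟨K', hK'⟩ := hl.exists_lipschitz_inv
  obtain ⟨C, hC⟩ := hl.upper
  have hC0 : 0 ≤ C := (abs_nonneg _).trans (hC 0)
  set q : ℝ → ℝ := deriv fun x => (l x)⁻¹ with hq
  have hqm : Measurable q := measurable_deriv _
  have hqK : ∀ x, |q x| ≤ K' := fun x => norm_deriv_le_of_lipschitz hK'
  -- Chosen so that both `δ ≤ ε` and `(C + K) * δ ≤ ε`, the bound of the residual below.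
  set δ : ℝ := ε / (1 + C + K) with hδ
  have hden : 0 < 1 + C + (K : ℝ) := by positivity
  have hδ0 : 0 < δ := div_pos hε hden
  have hδε : δ ≤ ε := div_le_self hε.le (by linarith [K.2, NNReal.coe_nonneg K])
  obtain ⟨h, hh, -⟩ := (memLp_of_bound hqm (fun x _ => hqK x)).exists_boundedContinuous_eLpNorm_sub_le
    (by simp) (ε := ENNReal.ofReal δ) (by simpa using hδ0)
  have hhc : Continuous h := h.continuous
  have hprob : IsProbabilityMeasure (volume.restrict (Ioo (0 : ℝ) 1)) := ⟨by simp⟩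
  have hint : ∀ x, IntervalIntegrable h volume 0 x := fun x => hhc.intervalIntegrable _ _
  have hqint : ∀ x, IntervalIntegrable q volume 0 x := fun x => by
    rw [intervalIntegrable_iff]
    exact Measure.integrableOn_of_bounded (M := K') (by simp) hqm.aestronglyMeasurable
      (Filter.Eventually.of_forall hqK)
  -- A primitive of a continuous `L²` approximation of `(1 / l)'`, with the exact value at `0`: the
  -- boundary condition of test functions there must hold without error.
  let g : ℝ → ℝ := fun x => (l 0)⁻¹ + ∫ s in (0 : ℝ)..x, h s
  have hg : ∀ x ∈ Icc (0 : ℝ) 1, |g x - (l x)⁻¹| ≤ δ := by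
    intro x hx
    have h1 := (hK'.lipschitzOnWith (s := uIcc 0 x)).absolutelyContinuousOnInterval.integral_deriv_eq_sub
    have h2 : g x - (l x)⁻¹ = ∫ s in (0 : ℝ)..x, (h s - q s) := by
      rw [intervalIntegral.integral_sub (hint x) (hqint x), hq, h1]
      simp only [g]
      ring
    have hi : IntegrableOn (fun s => |q s - h s|) (Ioo 0 1) :=
      ((hqint 1).sub (hint 1)).norm.1.mono_set Ioo_subset_Ioc_self
    calc |g x - (l x)⁻¹| ≤ ∫ s in Ioo 0 x, |q s - h s| := by
          rw [h2, intervalIntegral.integral_of_le hx.1, integral_Ioc_eq_integral_Ioo]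
          simp only [abs_sub_comm (q _)]
          exact abs_integral_le_integral_abs
      _ ≤ ∫ s in Ioo (0 : ℝ) 1, |q s - h s| :=
          setIntegral_mono_set hi (Filter.Eventually.of_forall fun s => abs_nonneg _)
            (Ioo_subset_Ioo_right hx.2).eventuallyLE
      _ ≤ δ := by
          have h3 := (eLpNorm_le_eLpNorm_of_exponent_le (one_le_two (α := ENNReal))
            ((hqm.sub hhc.measurable).aestronglyMeasurable
              (μ := volume.restrict (Ioo (0 : ℝ) 1)))).trans hh
          rw [eLpNorm_one_eq_lintegral_enorm] at h3
          simp only [Pi.sub_apply] at h3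
          rw [← ofReal_integral_norm_eq_lintegral_enorm ((hqint 1).sub (hint 1) |>.1.mono_set Ioo_subset_Ioc_self),
            ENNReal.ofReal_le_ofReal_iff hδ0.le] at h3
          exact h3
  refine ⟨g, h, by simp [g], hhc, fun x => ?_, fun x hx => (hg x hx).trans hδε, ?_⟩
  · exact ((hhc.integral_hasStrictDerivAt 0 x).hasDerivAt).const_add _
  · have hae : ∀ᵐ x ∂(volume.restrict (Ioo (0 : ℝ) 1)),
        ‖l x * h x + deriv l x * g x‖ ≤ ‖C * ‖(q - h) x‖ + K * δ‖ := by
      filter_upwards [ae_restrict_of_ae hK.ae_differentiableAt_real,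
        ae_restrict_mem measurableSet_Ioo] with x hx hx'
      have hqx : q x = -deriv l x / l x ^ 2 := (hx.hasDerivAt.inv (hl.ne_zero x)).deriv
      have h0 := hl.ne_zero x
      -- The expression would vanish for `g = 1 / l`, `h = q`, as the derivative of `l * (1 / l) =
      -- 1`; only the two approximation errors remain.
      have h1 : l x * h x + deriv l x * g x =
          l x * (h x - q x) + deriv l x * (g x - (l x)⁻¹) := by
        rw [hqx]
        field_simp
        ring
      rw [h1]
      refine (norm_add_le _ _).trans ((add_le_add ?_ ?_).trans (le_abs_self _))
      · rw [norm_mul, Pi.sub_apply, norm_sub_rev (h x)]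
        exact mul_le_mul_of_nonneg_right (hC x) (norm_nonneg _)
      · rw [norm_mul]
        exact mul_le_mul (norm_deriv_le_of_lipschitz hK) (hg x (Ioo_subset_Icc_self hx'))
          (norm_nonneg _) K.2
    refine (eLpNorm_mono_ae hae).trans ?_
    have hm : AEStronglyMeasurable (fun x => C * ‖(q - h) x‖) (volume.restrict (Ioo (0 : ℝ) 1)) :=
      ((hqm.sub hhc.measurable).norm.const_mul C).aestronglyMeasurable
    refine (eLpNorm_add_le hm aestronglyMeasurable_const one_le_two).trans ?_
    have e1 : eLpNorm (fun x => C * ‖(q - h) x‖) 2 (volume.restrict (Ioo (0 : ℝ) 1)) ≤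
        ENNReal.ofReal (C * δ) := by
      rw [show (fun x => C * ‖(q - h) x‖) = C • fun x => ‖(q - h) x‖ from rfl, eLpNorm_const_smul,
        eLpNorm_norm, Real.enorm_eq_ofReal hC0, ENNReal.ofReal_mul hC0]
      gcongr
    have e2 : eLpNorm (fun _ : ℝ => K * δ) 2 (volume.restrict (Ioo (0 : ℝ) 1)) ≤
        ENNReal.ofReal (K * δ) :=
      eLpNorm_le_of_bound fun x _ => (abs_of_nonneg (by positivity)).le
    refine (add_le_add e1 e2).trans ?_
    rw [← ENNReal.ofReal_add (by positivity) (by positivity)]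
    refine ENNReal.ofReal_le_ofReal ?_
    rw [← add_mul, hδ, mul_div_assoc', div_le_iff₀ hden]
    nlinarith

end IsSpeed

/-! ### Hidden adjoint solutions and duality -/

/-- `f` is a family of profiles of a solution of the adjoint system on `[0,T]` that is not seen by
the control. -/
structure IsHiddenFamily (lam : Fin p ⊕ Fin m → ℝ → ℝ) (Q : Matrix (Fin p) (Fin m) ℝ) (T : ℝ)
    (f : Fin p ⊕ Fin m → ℝ → ℝ) : Prop where
  contDiff : ∀ k, ContDiff ℝ 1 (f k)
  bounded : ∃ B, ∀ k s, |f k s| ≤ B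
  left : ∀ t ∈ Icc 0 T, ∀ j, f (Sum.inr j) t = -∑ i, Q i j * f (Sum.inl i) t
  right : ∀ t ∈ Icc 0 T, ∀ k, f k (t + componentPhase lam k 1) = 0

/-- The adjoint solution itself has the factor `1 / lam k`, which need not be `C¹`. Replacing it by
`g k` keeps the boundary conditions exact: at `x = 0` the two agree, and at `x = 1` the profiles
vanish. -/
theorem IsHiddenFamily.isTestFunction (hLip : IsLipschitzDiag lam) (hOrd : IsOrderedSpeeds lam)
    {Q : Matrix (Fin p) (Fin m) ℝ} {T : ℝ} {f : Fin p ⊕ Fin m → ℝ → ℝ}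
    (hf : IsHiddenFamily lam Q T f) {g h : Fin p ⊕ Fin m → ℝ → ℝ}
    (hg0 : ∀ k, g k 0 = (lam k 0)⁻¹) (hh : ∀ k, Continuous (h k))
    (hgh : ∀ k x, HasDerivAt (g k) (h k x) x) :
    IsTestFunction lam Q T fun k z => g k z.2 * f k (z.1 + componentPhase lam k z.2) := by
  have hs := isSpeed_of_isOrderedSpeeds hLip hOrd
  refine ⟨fun k => ContDiff.contDiffOn ?_, fun t ht i => ?_, fun t ht j => ?_⟩
  · have hg : ContDiff ℝ 1 (g k) := by
      rw [contDiff_one_iff_deriv]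
      refine ⟨fun x => (hgh k x).differentiableAt, ?_⟩
      rw [show deriv (g k) = h k from funext fun x => (hgh k x).deriv]
      exact hh k
    exact (hg.comp contDiff_snd).mul ((hf.contDiff k).comp
      (contDiff_fst.add ((hs k).contDiff_phase.comp contDiff_snd)))
  · simp only [hf.right t ht, mul_zero]
  · simp only [componentPhase_zero, add_zero, hg0, hf.left t ht j, Matrix.mulVec, dotProduct,
      mul_neg, Finset.mul_sum, ← Finset.sum_neg_distrib]
    refine Finset.sum_congr rfl fun i _ => ?_
    have h1 := hOrd.ne_zero (Sum.inr j) 0 (by simp)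
    have h2 := hOrd.ne_zero (Sum.inl i) 0 (by simp)
    simp only [adjointBoundaryMatrix, Matrix.transpose_apply, Matrix.neg_apply,
      Matrix.mul_diagonal, Matrix.diagonal_mul]
    field_simp

/-- Solutions from rest are orthogonal to hidden families. -/
theorem IsHiddenFamily.sum_integral_eq_zero (hLip : IsLipschitzDiag lam)
    (hOrd : IsOrderedSpeeds lam) {Q : Matrix (Fin p) (Fin m) ℝ} {T : ℝ} (hT : 0 < T)
    {f : Fin p ⊕ Fin m → ℝ → ℝ} (hf : IsHiddenFamily lam Q T f) {u : ControlSpace m}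
    {y : ℝ → StateSpace p m} (hy : IsWeakSolution lam Q 0 u y) :
    ∑ k, ∫ x in Ioo (0 : ℝ) 1,
      y T k x * (f k (T + componentPhase lam k x) * (extendSpeed (lam k) x)⁻¹) = 0 := by
  have hs := isSpeed_of_isOrderedSpeeds hLip hOrd
  have hσ : ∀ k, Continuous (componentPhase lam k) := fun k => (hs k).continuous_phase
  have hfc : ∀ k, Continuous (f k) := fun k => (hf.contDiff k).continuous
  obtain ⟨B, hB⟩ := hf.bounded
  rcases isEmpty_or_nonempty (Fin p ⊕ Fin m) with hemp | ⟨⟨k₀⟩⟩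
  · simp
  have hB0 : 0 ≤ B := (abs_nonneg _).trans (hB k₀ 0)
  obtain ⟨Y, hY⟩ := (isCompact_Icc (a := 0) (b := T)).exists_bound_of_continuousOn
    (hy.1.mono Icc_subset_Ici_self)
  have hY' : ∀ t ∈ Icc 0 T, ∀ k, ‖y t k‖ ≤ Y := fun t ht k =>
    (PiLp.norm_apply_le (y t) k).trans (hY t ht)
  have hY0 : 0 ≤ Y := (norm_nonneg _).trans (hY 0 ⟨le_rfl, hT.le⟩)
  set N : ℝ := (Fintype.card (Fin p ⊕ Fin m) : ℝ)
  refine abs_eq_zero.1 (le_antisymm (le_of_forall_pos_le_add fun ε hε => ?_) (abs_nonneg _))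
  have hden : 0 < N * (Y * B) * (1 + T) + 1 := by positivity
  -- The residual, integrated over `(0,T)`, costs at most `N * Y * B * δ * T`, and the return from
  -- `g` to the inverse speed at time `T` at most `N * Y * B * δ`; the summand `1` keeps the
  -- denominator positive.
  set δ := ε / (N * (Y * B) * (1 + T) + 1) with hδ
  have hδ0 : 0 < δ := div_pos hε hden
  choose g h hg0 hh hgh hgapprox hres using fun k => (hs k).exists_inv_approx hδ0
  have hg0' : ∀ k, g k 0 = (lam k 0)⁻¹ := fun k => by
    rw [hg0, extendSpeed_eq _ (by simp)]
  have hgc : ∀ k, Continuous (g k) := fun k =>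
    continuous_iff_continuousAt.2 fun x => (hgh k x).continuousAt
  have hweak := hy.2 T hT _ (hf.isTestFunction hLip hOrd hg0' hh hgh)
  -- the initial term and the control term vanish
  have hinit : ∫ x in Ioo (0 : ℝ) 1, ∑ k, (0 : StateSpace p m) k x *
      (g k x * f k (0 + componentPhase lam k x)) = 0 := by
    refine integral_eq_zero_of_ae ?_
    filter_upwards [Lp.coeFn_zero ℝ 2 (volume.restrict (Ioo (0 : ℝ) 1))] with x hx
    simp only [PiLp.zero_apply, Pi.zero_apply, hx, zero_mul, Finset.sum_const_zero]
  have hcontrol : ∫ t in Ioo (0 : ℝ) T, ∑ j : Fin m, u j t * (lam (Sum.inr j) 1 *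
      (g (Sum.inr j) 1 * f (Sum.inr j) (t + componentPhase lam (Sum.inr j) 1))) = 0 := by
    refine (setIntegral_congr_fun measurableSet_Ioo fun t ht => ?_).trans (integral_zero _ _)
    simp [hf.right t (Ioo_subset_Icc_self ht)]
  rw [hinit, hcontrol, sub_zero, add_zero] at hweak
  -- the residual
  let r : Fin p ⊕ Fin m → ℝ → ℝ → ℝ := fun k t x =>
    -((extendSpeed (lam k) x * h k x + deriv (extendSpeed (lam k)) x * g k x) *
      f k (t + componentPhase lam k x))
  have hrm : ∀ k t, Measurable (r k t) := fun k t => by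
    have h1 := (hs k).continuous.measurable
    have h2 := measurable_deriv (extendSpeed (lam k))
    have h3 := (hh k).measurable
    have h4 := (hgc k).measurable
    have h5 : Measurable fun x => f k (t + componentPhase lam k x) :=
      ((hfc k).comp (continuous_const.add (hσ k))).measurable
    exact (((h1.mul h3).add (h2.mul h4)).mul h5).neg
  have hr : ∀ k t, eLpNorm (r k t) 2 (volume.restrict (Ioo 0 1)) ≤ ENNReal.ofReal (B * δ) := by
    intro k t
    refine (eLpNorm_le_mul_eLpNorm_of_ae_le_mul (c := B) (g := fun x =>
      extendSpeed (lam k) x * h k x + deriv (extendSpeed (lam k)) x * g k x)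
      (Filter.Eventually.of_forall fun x => ?_) 2).trans ?_
    · rw [norm_neg, norm_mul, mul_comm]
      exact mul_le_mul_of_nonneg_right (hB k _) (norm_nonneg _)
    · rw [ENNReal.ofReal_mul hB0]
      exact mul_le_mul_right (hres k) _
  have hrL : ∀ k t, MemLp (r k t) 2 (volume.restrict (Ioo 0 1)) := fun k t =>
    ⟨(hrm k t).aestronglyMeasurable, (hr k t).trans_lt ENNReal.ofReal_lt_top⟩
  have hinner : ∀ t ∈ Ioo 0 T, ‖∫ x in Ioo (0 : ℝ) 1, ∑ k, y t k x *
      (deriv (fun s => g k x * f k (s + componentPhase lam k x)) t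
        - lam k x * deriv (fun ξ => g k ξ * f k (t + componentPhase lam k ξ)) x
        - deriv (lam k) x * (g k x * f k (t + componentPhase lam k x)))‖ ≤ N * (Y * (B * δ)) := by
    intro t ht
    have e : ∫ x in Ioo (0 : ℝ) 1, ∑ k, y t k x *
      (deriv (fun s => g k x * f k (s + componentPhase lam k x)) t
        - lam k x * deriv (fun ξ => g k ξ * f k (t + componentPhase lam k ξ)) x
        - deriv (lam k) x * (g k x * f k (t + componentPhase lam k x))) =
        ∑ k, ∫ x in Ioo (0 : ℝ) 1, y t k x * r k t x := by
      rw [← integral_finsetSum _ fun k _ => integrable_Lp_mul (y t k) (hrL k t)]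
      refine setIntegral_congr_fun measurableSet_Ioo fun x hx => ?_
      refine Finset.sum_congr rfl fun k _ => ?_
      have hfd : ∀ s, HasDerivAt (f k) (deriv (f k) s) s := fun s =>
        ((hf.contDiff k).differentiable one_ne_zero s).hasDerivAt
      have d1 : HasDerivAt (fun s => g k x * f k (s + componentPhase lam k x))
          (g k x * deriv (f k) (t + componentPhase lam k x)) t :=
        ((hfd _).comp_add_const t _).const_mul _
      have d2 : HasDerivAt (fun ξ => f k (t + componentPhase lam k ξ))
          (deriv (f k) (t + componentPhase lam k x) * (extendSpeed (lam k) x)⁻¹) x :=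
        (hfd _).comp x (((hs k).hasDerivAt_phase x).const_add t)
      have d3 := (hgh k x).fun_mul d2
      -- The terms with the derivative of `f k` cancel, since the phase has derivative `1 / l`; what
      -- is left is the small factor of `exists_inv_approx` times `f k`.
      rw [d1.deriv, d3.deriv, ← extendSpeed_eq (lam k) (Ioo_subset_Icc_self hx),
        ← deriv_extendSpeed _ hx]
      simp only [r]
      have := (hs k).ne_zero x
      field_simp
      ring
    rw [e]
    refine (norm_sum_le _ _).trans ((Finset.sum_le_card_nsmul _ _ (Y * (B * δ)) fun k _ => ?_).trans
      (by simp [N]))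
    exact (abs_integral_mul_le _ (hrL k t) (by positivity) (hr k t)).trans
      (mul_le_mul_of_nonneg_right (hY' t (Ioo_subset_Icc_self ht) k) (by positivity))
  have hbound := norm_setIntegral_le_of_norm_le_const (μ := volume) (s := Ioo 0 T) (by simp) hinner
  simp only at hweak
  rw [← hweak] at hbound
  -- comparison of `g` with `1 / l`
  let G : Fin p ⊕ Fin m → ℝ → ℝ := fun k x =>
    f k (T + componentPhase lam k x) * ((extendSpeed (lam k) x)⁻¹ - g k x)
  have hfσ : ∀ k, Continuous fun x => f k (T + componentPhase lam k x) := fun k =>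
    (hfc k).comp (continuous_const.add (hσ k))
  have hL2 : ∀ {w : ℝ → ℝ}, Continuous w → MemLp w 2 (volume.restrict (Ioo 0 1)) := fun hw =>
    memLp_of_bound hw.measurable (continuous_bounded_on_Ioo hw).choose_spec
  have hG2 : ∀ k, MemLp (G k) 2 (volume.restrict (Ioo 0 1)) := fun k =>
    hL2 ((hfσ k).mul ((hs k).continuous_inv.sub (hgc k)))
  have hgf2 : ∀ k, MemLp (fun x => g k x * f k (T + componentPhase lam k x)) 2
      (volume.restrict (Ioo 0 1)) := fun k => hL2 ((hgc k).mul (hfσ k))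
  have hGn : ∀ k, eLpNorm (G k) 2 (volume.restrict (Ioo 0 1)) ≤ ENNReal.ofReal (B * δ) := fun k =>
    eLpNorm_le_of_bound fun x hx => by
      rw [abs_mul, abs_sub_comm]
      exact mul_le_mul (hB _ _) (hgapprox k x (Ioo_subset_Icc_self hx)) (abs_nonneg _) hB0
  have hsplit : ∑ k, ∫ x in Ioo (0 : ℝ) 1,
      y T k x * (f k (T + componentPhase lam k x) * (extendSpeed (lam k) x)⁻¹) =
      (∫ x in Ioo (0 : ℝ) 1, ∑ k, y T k x * (g k x * f k (T + componentPhase lam k x))) +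
        ∑ k, ∫ x in Ioo (0 : ℝ) 1, y T k x * G k x := by
    rw [integral_finsetSum _ fun k _ => integrable_Lp_mul (y T k) (hgf2 k),
      ← Finset.sum_add_distrib]
    refine Finset.sum_congr rfl fun k _ => ?_
    rw [← integral_add (integrable_Lp_mul (y T k) (hgf2 k)) (integrable_Lp_mul (y T k) (hG2 k))]
    refine integral_congr_ae (Filter.Eventually.of_forall fun x => ?_)
    simp only [G]
    ring
  have hsum : |∑ k, ∫ x in Ioo (0 : ℝ) 1, y T k x * G k x| ≤ N * (Y * (B * δ)) := by
    refine (Finset.abs_sum_le_sum_abs _ _).trans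
      ((Finset.sum_le_card_nsmul _ _ (Y * (B * δ)) fun k _ => ?_).trans (by simp [N]))
    exact (abs_integral_mul_le _ (hG2 k) (by positivity) (hGn k)).trans
      (mul_le_mul_of_nonneg_right (hY' T ⟨hT.le, le_rfl⟩ k) (by positivity))
  have hvol : (volume : Measure ℝ).real (Ioo 0 T) = T := by simp [Measure.real, hT.le]
  rw [hvol, Real.norm_eq_abs] at hbound
  rw [hsplit, zero_add]
  refine (abs_add_le _ _).trans ((add_le_add hbound hsum).trans ?_)
  calc N * (Y * (B * δ)) * T + N * (Y * (B * δ)) = δ * (N * (Y * B) * (1 + T)) := by ring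
    _ ≤ δ * (N * (Y * B) * (1 + T) + 1) := by
        exact mul_le_mul_of_nonneg_left (by linarith) hδ0.le
    _ = ε := div_mul_cancel₀ _ hden.ne'

/-- Exact controllability excludes nontrivial hidden families. -/
theorem IsHiddenFamily.eq_zero (hLip : IsLipschitzDiag lam)
    (hOrd : IsOrderedSpeeds lam) {Q : Matrix (Fin p) (Fin m) ℝ} {T : ℝ} (hT : 0 < T)
    {f : Fin p ⊕ Fin m → ℝ → ℝ} (hf : IsHiddenFamily lam Q T f)
    (hctrl : IsExactlyControllable lam Q T) (k : Fin p ⊕ Fin m) {x : ℝ} (hx : x ∈ Ioo (0 : ℝ) 1) :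
    f k (T + componentPhase lam k x) = 0 := by
  have hs := isSpeed_of_isOrderedSpeeds hLip hOrd
  have hfσ : ∀ k, Continuous fun x => f k (T + componentPhase lam k x) := fun k =>
    (hf.contDiff k).continuous.comp (continuous_const.add (hs k).continuous_phase)
  have hw : ∀ k, Continuous fun x => extendSpeed (lam k) x * f k (T + componentPhase lam k x) :=
    fun k => (hs k).continuous.mul (hfσ k)
  have hw2 : ∀ k, MemLp (fun x => extendSpeed (lam k) x * f k (T + componentPhase lam k x)) 2
      (volume.restrict (Ioo 0 1)) := fun k =>
    memLp_of_bound (hw k).measurable (continuous_bounded_on_Ioo (hw k)).choose_spec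
  -- The target is the profile times the speed, so that the pairing, which has the weight of the
  -- inverse speed, becomes a sum of integrals of squares.
  obtain ⟨u, y, hy, hyT⟩ := hctrl 0 (WithLp.toLp 2 fun k => (hw2 k).toLp)
  have h0 := hf.sum_integral_eq_zero hLip hOrd hT hy
  have h1 : ∀ k, ∫ x in Ioo (0 : ℝ) 1,
      y T k x * (f k (T + componentPhase lam k x) * (extendSpeed (lam k) x)⁻¹) =
      ∫ x in Ioo (0 : ℝ) 1, f k (T + componentPhase lam k x) ^ 2 := by
    intro k
    refine integral_congr_ae ?_
    rw [hyT]
    filter_upwards [(hw2 k).coeFn_toLp] with x hx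
    have := (hs k).ne_zero x
    simp only [hx]
    field_simp
  simp only [h1] at h0
  have h2 := (Finset.sum_eq_zero_iff_of_nonneg fun k _ =>
    integral_nonneg fun x => sq_nonneg _).1 h0 k (Finset.mem_univ k)
  have hi : IntegrableOn (fun x => f k (T + componentPhase lam k x) ^ 2) (Ioo 0 1) :=
    (((hfσ k).pow 2).continuousOn.integrableOn_compact isCompact_Icc).mono_set Ioo_subset_Icc_self
  rw [integral_eq_zero_iff_of_nonneg (fun x => sq_nonneg _) hi] at h2
  have h3 := Measure.eqOn_open_of_ae_eq h2 isOpen_Ioo ((hfσ k).pow 2).continuousOn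
    continuousOn_const hx
  simpa using h3

/-! ### Necessity: obstructions from bumps -/

/-- A smooth function that is positive on `(a,b)` and zero elsewhere. -/
noncomputable def bump (a b s : ℝ) : ℝ := Real.smoothTransition (s - a) * Real.smoothTransition (b - s)

theorem contDiff_bump (a b : ℝ) : ContDiff ℝ 1 (bump a b) :=
  (Real.smoothTransition.contDiff.comp (contDiff_id.sub contDiff_const)).mul
    (Real.smoothTransition.contDiff.comp (contDiff_const.sub contDiff_id))

theorem abs_bump_le_one (a b s : ℝ) : |bump a b s| ≤ 1 := by
  rw [bump, abs_mul, abs_of_nonneg (Real.smoothTransition.nonneg _),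
    abs_of_nonneg (Real.smoothTransition.nonneg _)]
  exact mul_le_one₀ (Real.smoothTransition.le_one _) (Real.smoothTransition.nonneg _)
    (Real.smoothTransition.le_one _)

theorem bump_eq_zero_of_le {a b s : ℝ} (h : s ≤ a) : bump a b s = 0 := by
  rw [bump, Real.smoothTransition.zero_of_nonpos (sub_nonpos.2 h), zero_mul]

theorem bump_eq_zero_of_ge {a b s : ℝ} (h : b ≤ s) : bump a b s = 0 := by
  rw [bump, Real.smoothTransition.zero_of_nonpos (sub_nonpos.2 h), mul_zero]

theorem bump_midpoint_pos {a b : ℝ} (h : a < b) : 0 < bump a b ((a + b) / 2) :=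
  mul_pos (Real.smoothTransition.pos_of_pos (by linarith))
    (Real.smoothTransition.pos_of_pos (by linarith))

/-- For `t` in `[0,T]` the argument at `x = 1` sweeps an interval of length `T` that starts at
`componentPhase lam k 1`; `hright` keeps this interval off `(a,b)`, where the bump lives. -/
theorem IsHiddenFamily.of_smul_bump {Q : Matrix (Fin p) (Fin m) ℝ} {T a b : ℝ}
    {ζ : Fin p ⊕ Fin m → ℝ}
    (hleft : ∀ t ∈ Icc 0 T, ∀ j, ζ (Sum.inr j) * bump a b t =
      -∑ i, Q i j * (ζ (Sum.inl i) * bump a b t))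
    (hright : ∀ k, ζ k ≠ 0 → T + componentPhase lam k 1 ≤ a ∨ b ≤ componentPhase lam k 1) :
    IsHiddenFamily lam Q T fun k s => ζ k * bump a b s := by
  refine ⟨fun k => contDiff_const.mul (contDiff_bump a b), ⟨∑ k, |ζ k|, fun k s => ?_⟩, hleft,
    fun t ht k => ?_⟩
  · rw [abs_mul]
    exact (mul_le_of_le_one_right (abs_nonneg _) (abs_bump_le_one _ _ _)).trans
      (Finset.single_le_sum (f := fun k => |ζ k|) (fun _ _ => abs_nonneg _) (Finset.mem_univ k))
  · by_cases hk : ζ k = 0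
    · rw [hk, zero_mul]
    · rcases hright k hk with h | h
      · rw [bump_eq_zero_of_le (by linarith [ht.2]), mul_zero]
      · rw [bump_eq_zero_of_ge (by linarith [ht.1]), mul_zero]

/-- If `T` is shorter than the crossing time, part of component `j` at time `T` is still transported
initial data. A bump on `(T, T_{p+j})` detects it, and is invisible at `x = 0` up to time `T`. -/
theorem travelTime_inr_le_of_isExactlyControllable (hLip : IsLipschitzDiag lam)
    (hOrd : IsOrderedSpeeds lam) {Q : Matrix (Fin p) (Fin m) ℝ} {T : ℝ} (hT : 0 < T)
    (hctrl : IsExactlyControllable lam Q T) (j : Fin m) : travelTime lam (Sum.inr j) ≤ T := by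
  classical
  by_contra! hlt
  have hf : IsHiddenFamily lam Q T fun k s =>
      (Pi.single (Sum.inr j) 1 : Fin p ⊕ Fin m → ℝ) k *
        bump T (travelTime lam (Sum.inr j)) s := by
    refine IsHiddenFamily.of_smul_bump (fun t ht j' => ?_) fun k hk => ?_
    · simp [bump_eq_zero_of_le ht.2]
    · have hkj : k = Sum.inr j := by
        by_contra hne
        exact hk (Pi.single_eq_of_ne hne _)
      rw [hkj, travelTime_inr hLip hOrd]
      exact Or.inr le_rfl
  have hmem : (travelTime lam (Sum.inr j) - T) / 2 ∈
      Ioo (componentPhase lam (Sum.inr j) 0) (componentPhase lam (Sum.inr j) 1) := by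
    rw [componentPhase_zero, ← travelTime_inr hLip hOrd]
    constructor <;> linarith
  obtain ⟨x, hx, hxe⟩ := intermediate_value_Ioo zero_le_one
    (isSpeed_of_isOrderedSpeeds hLip hOrd (Sum.inr j)).continuous_phase.continuousOn hmem
  have h0 := hf.eq_zero hLip hOrd hT hctrl (Sum.inr j) hx
  have hxe' : T + componentPhase lam (Sum.inr j) x = (T + travelTime lam (Sum.inr j)) / 2 := by
    rw [componentPhase, hxe]
    ring
  rw [Pi.single_eq_same, one_mul, hxe'] at h0
  exact (bump_midpoint_pos hlt).ne' h0

/-- A combination of rows of `Q` that is blind to the controllable columns during a time interval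
obstructs exact controllability. -/
theorem not_isExactlyControllable_of_combination (hLip : IsLipschitzDiag lam)
    (hOrd : IsOrderedSpeeds lam) {Q : Matrix (Fin p) (Fin m) ℝ} {T a b : ℝ} (hT : 0 < T)
    (hab : a < b) (hbT : b ≤ T) {η : Fin p → ℝ} (hη : η ≠ 0)
    (hrow : ∀ i, η i ≠ 0 → T - travelTime lam (Sum.inl i) ≤ a)
    (hcol : ∀ j, ∑ i, η i * Q i j ≠ 0 → b ≤ travelTime lam (Sum.inr j)) :
    ¬IsExactlyControllable lam Q T := by
  intro hctrl
  -- The second block is forced by the adjoint condition at `x = 0`; `hcol` makes the columns that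
  -- occur too slow for the control to reach `x = 0` before time `b`.
  let ζ : Fin p ⊕ Fin m → ℝ := Sum.elim η fun j => -∑ i, η i * Q i j
  have hf : IsHiddenFamily lam Q T fun k s => ζ k * bump a b s := by
    refine IsHiddenFamily.of_smul_bump (fun t _ j => ?_) ?_
    · simp only [ζ, Sum.elim_inl, Sum.elim_inr, neg_mul, Finset.sum_mul, neg_inj]
      exact Finset.sum_congr rfl fun i _ => by ring
    · rintro (i | j) hk
      · left
        have := hrow i hk
        rw [travelTime_inl hLip hOrd] at this
        linarith
      · right
        rw [← travelTime_inr hLip hOrd]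
        exact hcol j fun h => hk (by simp [ζ, h])
  obtain ⟨i, hi⟩ := Function.ne_iff.1 hη
  have hrowi := hrow i hi
  -- The midpoint of the bump lies in `(T - T_i, T)`, the times at which component `i` of the final
  -- state left `x = 0`.
  have hmem : (a + b) / 2 - T ∈
      Ioo (componentPhase lam (Sum.inl i) 1) (componentPhase lam (Sum.inl i) 0) := by
    rw [travelTime_inl hLip hOrd] at hrowi
    rw [componentPhase_zero]
    constructor <;> linarith
  obtain ⟨x, hx, hxe⟩ := intermediate_value_Ioo' zero_le_one
    (isSpeed_of_isOrderedSpeeds hLip hOrd (Sum.inl i)).continuous_phase.continuousOn hmem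
  have h0 := hf.eq_zero hLip hOrd hT hctrl (Sum.inl i) hx
  have hxe' : T + componentPhase lam (Sum.inl i) x = (a + b) / 2 := by
    rw [componentPhase, hxe]
    ring
  rw [hxe'] at h0
  exact mul_ne_zero hi (bump_midpoint_pos hab).ne' h0

/-- A left annihilator of `Q` kills every column, so only the rows restrict the window. Index `0`
has the shortest travel time, hence `(T - T_1, T)` suits all rows. -/
theorem rank_eq_of_isExactlyControllable [NeZero p] (hLip : IsLipschitzDiag lam)
    (hOrd : IsOrderedSpeeds lam) {Q : Matrix (Fin p) (Fin m) ℝ} {T : ℝ} (hT : 0 < T)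
    (hctrl : IsExactlyControllable lam Q T) : Q.rank = p := by
  by_contra hQ
  obtain ⟨η, hη, hQη⟩ := exists_left_annihilator hQ
  refine not_isExactlyControllable_of_combination hLip hOrd hT
    (a := T - travelTime lam (Sum.inl 0)) (b := T) ?_ le_rfl hη (fun i _ => ?_)
    (fun j hj => absurd (hQη j) hj) hctrl
  · linarith [travelTime_pos hLip hOrd (Sum.inl 0)]
  · linarith [travelTime_inl_mono hLip hOrd (Fin.zero_le i)]

/-- If the inequality fails, the window from `T - T_i` to `min T T_{p+c_i}` is not empty. The
annihilator of `exists_annihilator` uses only rows from `i` on, which are at least as slow as row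
`i`, and sees only columns up to `c i`, which are at least as slow as column `c i`. -/
theorem travelTime_add_le_of_isExactlyControllable (hLip : IsLipschitzDiag lam)
    (hOrd : IsOrderedSpeeds lam) {Q : Matrix (Fin p) (Fin m) ℝ} {L : Matrix (Fin m) (Fin m) ℝ}
    {c : Fin p → Fin m} (hL : IsUnitLower L) (hc : IsCanonicalIndices (Q * L) c) {T : ℝ}
    (hT : 0 < T) (hctrl : IsExactlyControllable lam Q T) (i : Fin p) :
    travelTime lam (Sum.inl i) + travelTime lam (Sum.inr (c i)) ≤ T := by
  by_contra! hlt
  obtain ⟨η, hη, h1, h2⟩ := exists_annihilator hL hc i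
  refine not_isExactlyControllable_of_combination hLip hOrd hT
    (a := T - travelTime lam (Sum.inl i)) (b := min T (travelTime lam (Sum.inr (c i)))) ?_
    (min_le_left _ _) hη (fun k hk => ?_) (fun j hj => ?_) hctrl
  · exact lt_min (by linarith [travelTime_pos hLip hOrd (Sum.inl i)]) (by linarith)
  · have hik : i ≤ k := le_of_not_gt fun h => hk (h1 k h)
    linarith [travelTime_inl_mono hLip hOrd hik]
  · have hji : j ≤ c i := le_of_not_gt fun h => hj (h2 j h)
    exact (min_le_right _ _).trans (travelTime_inr_anti hLip hOrd hji)

theorem exists_isUnitLower_canonicalIndex (Q : Matrix (Fin p) (Fin m) ℝ) (hQ : Q.rank = p) :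
    ∃ L : Matrix (Fin m) (Fin m) ℝ, IsUnitLower L ∧
      IsCanonicalIndices (Q * L) (canonicalIndex Q hQ) := by
  have h : IsCanonicalFormOf Q _ := (existsUnique_canonicalForm Q hQ).choose_spec.1
  obtain ⟨L, hL, he⟩ := h.1
  refine ⟨L, hL, ?_⟩
  rw [he]
  exact h.2.choose_spec

end HyperbolicControl

theorem mainTheorem2 (p m : ℕ) [NeZero p] [NeZero m]
    (lam : Fin p ⊕ Fin m → ℝ → ℝ)
    (hLip : HyperbolicControl.IsLipschitzDiag lam)
    (hOrd : HyperbolicControl.IsOrderedSpeeds lam)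
    (Q : Matrix (Fin p) (Fin m) ℝ) (T : ℝ) (hT : 0 < T) :
    HyperbolicControl.IsExactlyControllable lam Q T ↔
      ∃ hQ : Q.rank = p, HyperbolicControl.controlTime lam Q hQ ≤ T := by
  constructor
  · intro hctrl
    have hQ := HyperbolicControl.rank_eq_of_isExactlyControllable hLip hOrd hT hctrl
    obtain ⟨L, hL, hc⟩ := HyperbolicControl.exists_isUnitLower_canonicalIndex Q hQ
    refine ⟨hQ, Finset.sup'_le _ _ fun i _ => max_le ?_ ?_⟩
    · exact HyperbolicControl.travelTime_inr_le_of_isExactlyControllable hLip hOrd hT hctrl 0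
    · exact HyperbolicControl.travelTime_add_le_of_isExactlyControllable hLip hOrd hL hc hT hctrl i
  · rintro ⟨hQ, hle⟩
    obtain ⟨L, hL, hc⟩ := HyperbolicControl.exists_isUnitLower_canonicalIndex Q hQ
    have h := fun i => (Finset.sup'_le_iff _ _).1 hle i (Finset.mem_univ i)
    refine HyperbolicControl.isExactlyControllable_of_le hLip hOrd hL hc (fun j => ?_)
      fun i => (le_max_right _ _).trans (h i)
    -- Column `0` is the slowest positive component, so its bound covers all columns.
    exact (HyperbolicControl.travelTime_inr_anti hLip hOrd (Fin.zero_le j)).trans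
      ((le_max_left _ _).trans (h 0))
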